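/- Let $d\ge 1$ and $I=\{1,\dots,d\}$. Order $\mathbb Z^d$ componentwise and let $\alpha\wedge\beta$ be the componentwise minimum; write $\alpha\ll\beta$ if $\alpha_i<\beta_i$ for all $i\in I$. A submonoid $S\subseteq\mathbb N^d$ is a *good semigroup* if (G1) $\alpha,\beta\in S$ implies $\alpha\wedge\beta\in S$; (G2) if $\alpha\ne\beta$ are in $S$ and $\alpha_i=\beta_i$, there is $\epsilon\in S$ with $\epsilon_i>\alpha_i$ and $\epsilon_j\ge\min(\alpha_j,\beta_j)$ for all $j\neq i$, with equality whenever $\alpha_j\ne\beta_j$; (G3) $c+\mathbb N^d\subseteq S$ for some $c\in S$. For $T\subseteq\mathbb N^d$, $F\subseteq I$ and $\alpha\in\mathbb Z^d$ put $\Delta^T_F(\alpha)=\{\beta\in T:\beta_i=\alpha_i\ (i\in F),\ \beta_j>\alpha_j\ (j\notin F)\}$, $\Delta^T(\alpha)=\bigcup_{i\in I}\Delta^T_{\{i\}}(\alpha)$ and $\Delta=\Delta^{\mathbb N^d}$. For $E\subseteq\mathbb N^d$ let $c_E$ be the least $\alpha\in\mathbb Z^d$ with $\alpha+\mathbb N^d\subseteq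 E$, and let $\gamma_E=c_E-(1,\dots,1)$; put $\gamma=\gamma_S$. Let $\boldsymbol e$ be the least element of $S$ with all components positive. *Levels.* A vector $\alpha$ is a complete infimum of elements of $B$ if there are $1<r\le d$, vectors $\beta^{(1)},\dots,\beta^{(r)}\in B$ and nonempty sets $F_k\subsetneq I$ with $\beta^{(k)}\in\Delta^B_{F_k}(\alpha)$ for all $k$, $\beta^{(j)}\wedge\beta^{(k)}=\alpha$ for $j\neq k$, and $\bigcap_k F_k=\emptyset$. For $A\subseteq\mathbb N^d$ define inductively $B^{(i)}$ as the set of those elements of $A\setminus\bigcup_{j<i}D^{(j)}$ that are not $\ll$ any other element of this set, and $D^{(i)}$ as the set of those elements of $B^{(i)}$ that are not complete infima of elements of $B^{(i)}$. Let $N$ be the least number with $A=D^{(1)}\cup\dots\cup D^{(N)}$. The *levels* of $A$ are $A_i=D^{(N+1-i)}$, $1\le i\le N$. If $A\subseteq T$ and $E=T\setminus A$, put $$A_i'=\Bigl(\bigcup_{\omega\in A_i}\Delta^T(\gamma_E-\omega)\Bigr)\setminus\Bigl(\bigcup_{j<i}\ \bigcup_{\omega\in A_j}\Delta^T(\gamma_E-\omega)\Bigr).$$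 Let $S\subseteq\mathbb N^d$ be a good semigroup. $S$ is *symmetric* if for all $\alpha\in\mathbb Z^d$: $\alpha\in S\iff\Delta^S(\gamma-\alpha)=\emptyset$. Let $\mathrm{PF}(S)$ be the set of $\alpha\in\mathbb N^d\setminus S$ with $\alpha+\beta\in S$ for all nonzero $\beta\in S$. $S$ is *almost symmetric* if $\mathrm{PF}(S)=\Delta(\gamma)\cup\{\alpha\in\mathbb N^d\setminus S:\Delta^S(\gamma-\alpha)=\emptyset\}$. Let $A=\mathrm{Ap}(S)=S\setminus(\boldsymbol e+S)$, with levels $A_1,\dots,A_e$, and let $$Z=\mathrm{PF}(S)\cup\{0\},\qquad W=\{0\}\cup\Delta(\gamma+\boldsymbol e)\cup\Bigl\{\alpha\in\bigcup_{i=2}^{e-1}A_i:\alpha-\boldsymbol e\notin\mathrm{PF}(S)\Bigr\},$$ with levels $Z_1,\dots,Z_n$ and $W_1,\dots,W_m$. Dual levels are formed with $T=S$ for $A$ and $W$, and with $T=S\cup\mathrm{PF}(S)$ for $Z$. Then: 1. $S$ is symmetric if and only if $A_i'=A_{e-i+1}$ for every $i=1,\dots,e$. 2. If $d=1$ or $S\ne\mathbb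 N^d$, then $S$ is almost symmetric if and only if $Z_h'=Z_{n-h+1}$ for every $h=1,\dots,n$ and $W_i'=W_{m-i+1}$ for every $i=1,\dots,m$. -/

import Mathlib

/-!
Good semigroups in `ℕ^d`, the partition of a complement into levels, and the level duality.

Vectors are functions `Fin d → ℤ` with the componentwise order, so that `α ⊓ β` is the
componentwise minimum and `ℕ^d` is the set of vectors `α` with `0 ≤ α`.
-/

namespace GoodSemigroup

variable {d : ℕ}

/-- `S` is a good semigroup: a submonoid of `ℕ^d` with the properties (G1), (G2) and (G3). -/
structure IsGood (S : AddSubmonoid (Fin d → ℤ)) : Prop where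
  nonneg : ∀ α ∈ S, 0 ≤ α
  inf_mem : ∀ α ∈ S, ∀ β ∈ S, α ⊓ β ∈ S
  exists_gt : ∀ α ∈ S, ∀ β ∈ S, α ≠ β → ∀ i, α i = β i →
    ∃ ε ∈ S, α i < ε i ∧
      ∀ j, j ≠ i → min (α j) (β j) ≤ ε j ∧ (α j ≠ β j → ε j = min (α j) (β j))
  exists_conductor : ∃ c ∈ S, ∀ ν : Fin d → ℤ, 0 ≤ ν → c + ν ∈ S

/-- The componentwise infimum of a set of vectors. It is used only for sets that possess a least
element, and then it is this least element. -/
noncomputable def leastVec (T : Set (Fin d → ℤ)) : Fin d → ℤ :=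
  fun i => sInf ((fun α : Fin d → ℤ => α i) '' T)

theorem leastVec_eq {T : Set (Fin d → ℤ)} {m : Fin d → ℤ} (h : IsLeast T m) :
    leastVec T = m := by
  funext i
  refine IsLeast.csInf_eq ⟨⟨m, h.1, rfl⟩, ?_⟩
  rintro _ ⟨α, hα, rfl⟩
  exact h.2 hα i

/-- The conductor of `E`: the least `α ∈ ℤ^d` with `α + ℕ^d ⊆ E`. -/
noncomputable def conductor (E : Set (Fin d → ℤ)) : Fin d → ℤ :=
  leastVec {α | ∀ ν : Fin d → ℤ, 0 ≤ ν → α + ν ∈ E}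

/-- The vector `γ_E = c_E - (1, …, 1)`. -/
noncomputable def gam (E : Set (Fin d → ℤ)) : Fin d → ℤ :=
  conductor E - 1

/-- The multiplicity `e` of `S`: its least element with all components positive. -/
noncomputable def mult (S : AddSubmonoid (Fin d → ℤ)) : Fin d → ℤ :=
  leastVec {α | α ∈ S ∧ ∀ i, 0 < α i}

/-- `Δ_F^T(α)`: the elements of `T` that equal `α` on `F` and are strictly larger off `F`. -/
def deltaSet (T : Set (Fin d → ℤ)) (F : Finset (Fin d)) (α : Fin d → ℤ) : Set (Fin d → ℤ) :=
  {β | β ∈ T ∧ (∀ i ∈ F, β i = α i) ∧ ∀ j, j ∉ F → α j < β j}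

/-- `Δ^T(α)`, the union over `i` of the sets `Δ_{i}^T(α)`. -/
def delta (T : Set (Fin d → ℤ)) (α : Fin d → ℤ) : Set (Fin d → ℤ) :=
  ⋃ i : Fin d, deltaSet T {i} α

/-- The set `ℕ^d`. -/
def natVec (d : ℕ) : Set (Fin d → ℤ) := {α | 0 ≤ α}

/-- `α` is the complete infimum of `r` elements of `B`, for some `r` with `1 < r ≤ d`. -/
def IsCompleteInf (B : Set (Fin d → ℤ)) (α : Fin d → ℤ) : Prop :=
  ∃ r : ℕ, 1 < r ∧ r ≤ d ∧ ∃ (β : Fin r → Fin d → ℤ) (F : Fin r → Finset (Fin d)),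
    (∀ k, (F k).Nonempty ∧ F k ≠ Finset.univ ∧ β k ∈ deltaSet B (F k) α) ∧
    (∀ j k, j ≠ k → α = β j ⊓ β k) ∧
    ∀ i, ∃ k, i ∉ F k

/-- `α ≪ β`: every component of `α` is strictly smaller than that of `β`. -/
def Dominated (α β : Fin d → ℤ) : Prop := ∀ i, α i < β i

/-- The elements of `R` that are maximal with respect to `≤≤` (that is, `=` or `≪`). -/
def maxElems (R : Set (Fin d → ℤ)) : Set (Fin d → ℤ) :=
  {α | α ∈ R ∧ ∀ β ∈ R, ¬ Dominated α β}

/-- The maximal elements of `R` that are not complete infima of maximal elements of `R`. -/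
def topLayer (R : Set (Fin d → ℤ)) : Set (Fin d → ℤ) :=
  {α | α ∈ maxElems R ∧ ¬ IsCompleteInf (maxElems R) α}

/-- What is left of `A` after the removal of the layers `D^(1), …, D^(k)`, where
`D^(k+1) = topLayer (remaining A k)`. -/
def remaining (A : Set (Fin d → ℤ)) : ℕ → Set (Fin d → ℤ)
  | 0 => A
  | k + 1 => remaining A k \ topLayer (remaining A k)

/-- The number `N` of levels of `A`: the least `N` with `A = D^(1) ∪ … ∪ D^(N)`. -/
noncomputable def numLevels (A : Set (Fin d → ℤ)) : ℕ :=
  sInf {N | remaining A N = ∅}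

/-- The level `A_i = D^(N+1-i)`, for `1 ≤ i ≤ N`. -/
noncomputable def level (A : Set (Fin d → ℤ)) (i : ℕ) : Set (Fin d → ℤ) :=
  topLayer (remaining A (numLevels A - i))

/-- For `A ⊆ T` with complement `E = T \ A`, the union of the sets `Δ^T(γ_E - ω)`, `ω ∈ A_i`. -/
noncomputable def dualUnion (T A : Set (Fin d → ℤ)) (i : ℕ) : Set (Fin d → ℤ) :=
  ⋃ ω ∈ level A i, delta T (gam (T \ A) - ω)

/-- The dual level `A_i'`. -/
noncomputable def dualLevel (T A : Set (Fin d → ℤ)) (i : ℕ) : Set (Fin d → ℤ) :=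
  dualUnion T A i \ ⋃ j ∈ Set.Ico 1 i, dualUnion T A j

/-- The level duality of `A`, as complement in `T` of `E = T \ A`: if `A` has `N` levels, then
`A_i' = A_{N-i+1}` for `i = 1, …, N`. -/
def LevelDuality (T A : Set (Fin d → ℤ)) : Prop :=
  ∀ i, 1 ≤ i → i ≤ numLevels A → dualLevel T A i = level A (numLevels A - i + 1)

/-- `S` is symmetric. -/
def IsSymmetric (S : AddSubmonoid (Fin d → ℤ)) : Prop :=
  ∀ α : Fin d → ℤ, α ∈ S ↔ delta (S : Set (Fin d → ℤ)) (gam (S : Set (Fin d → ℤ)) - α) = ∅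

/-- The set `PF(S)` of pseudo-Frobenius elements. -/
def PF (S : AddSubmonoid (Fin d → ℤ)) : Set (Fin d → ℤ) :=
  {α | α ∈ natVec d ∧ α ∉ S ∧ ∀ β ∈ S, β ≠ 0 → α + β ∈ S}

/-- `S` is almost symmetric. -/
def IsAlmostSymmetric (S : AddSubmonoid (Fin d → ℤ)) : Prop :=
  PF S = delta (natVec d) (gam (S : Set (Fin d → ℤ))) ∪
    {α | α ∈ natVec d ∧ α ∉ S ∧
      delta (S : Set (Fin d → ℤ)) (gam (S : Set (Fin d → ℤ)) - α) = ∅}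

/-- The Apéry set `Ap(S) = S \ (e + S)` with respect to the multiplicity `e`. -/
def Ap (S : AddSubmonoid (Fin d → ℤ)) : Set (Fin d → ℤ) :=
  {α | α ∈ S ∧ ¬ ∃ β ∈ S, α = mult S + β}

/-- `Z = PF(S) ∪ {0}`. -/
def setZ (S : AddSubmonoid (Fin d → ℤ)) : Set (Fin d → ℤ) := PF S ∪ {0}

/-- `W`: the vector `0`, the set `Δ(γ + e)`, and the elements `α` of the levels
`A_2, …, A_{N-1}` of the Apéry set with `α - e ∉ PF(S)`. -/
def setW (S : AddSubmonoid (Fin d → ℤ)) : Set (Fin d → ℤ) :=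
  {0} ∪ delta (natVec d) (gam (S : Set (Fin d → ℤ)) + mult S) ∪
    {α | (∃ i, 2 ≤ i ∧ i + 1 ≤ numLevels (Ap S) ∧ α ∈ level (Ap S) i) ∧ α - mult S ∉ PF S}

end GoodSemigroup

/-!
# Level duality for symmetric and almost symmetric good semigroups

Levels are fibres of a length function. For good sets `E ⊆ T` containing a common orthant, the
property (G2) says that the indicators of the faces met by `T` and by `E` are closed discrete
`1`-forms on `ℤ^d` (`faceInd_closed`), and their difference has a potential `f` that vanishes on
the orthant (`exists_isColength`). For value sets of modules, `f α` is the length of the quotient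
of the parts of `T` and `E` above `α`. An element of `T \ E` has larger `f` than every element that
dominates it and than some member of every family of which it is a complete infimum;
conversely, if `f α` is not minimal among the elements left, `α` is dominated or a complete
infimum (`IsColength.isCompleteInf`). Hence the `i`-th level of `T \ E` is the set where
`f = N - i + 1`, with `N` the number of levels (`IsColength.mem_level`).

The dual `E = {α | Δ^T(γ - α) = ∅}` of a good set `T` meets precisely those faces whose mirror
images under `α ↦ γ + 1 - α` are missed by `T` (`meetsFace_dualSet`); in particular `E` is good.
If `E ⊆ T`, this gives `f (γ + 1 - α) + f α = N`, so the largest value of `f` on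
`Δ^T(γ - β)` is `N + 1 - f β` for `β ∈ T \ E`, which is level duality
(`levelDuality_of_dualSet`).

For `S` symmetric, `e + S` is the dual of `S` with respect to `γ + e`. For `S` almost symmetric
and local, `S \ {0}` and `S ∪ PF(S)` are dual to each other with respect to `γ`, and `S \ W` is
the translate by `e` of the canonical ideal `K = {α | Δ^S(γ - α) = ∅}`; the latter uses that the
bottom level of the Apéry set is `{0}` and that its top level lies in `Δ(γ + e)`.

Conversely, the number of levels is finite without any assumption of duality
(`remaining_numLevels`), so level duality makes every element of the set dual to some other one
(`LevelDuality.exists_dual`). Starting from `α ∈ K \ S` and adding `e` until `S` is reached, one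
finds an element of the Apéry set (or of `W` or `Z`) without a dual, unless `α ∈ PF(S)` in the
almost symmetric case. If `S ≠ ℕ^d` is not local, then `PF(S)` is empty and both sides of the second
equivalence fail.
-/

namespace GoodSemigroup

variable {d : ℕ}

/-! ### Unit steps and induction along lattice paths -/

/-- The `i`-th unit vector of `ℤ^d`. -/
abbrev unitVec (i : Fin d) : Fin d → ℤ := Pi.single i 1

theorem unitVec_self (i : Fin d) : unitVec i i = 1 := by simp

theorem unitVec_ne {i j : Fin d} (h : j ≠ i) : unitVec i j = 0 := by simp [h]

theorem add_unitVec_le_iff {α β : Fin d → ℤ} {i : Fin d} :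
    α + unitVec i ≤ β ↔ α ≤ β ∧ α i < β i := by
  constructor
  · intro h
    refine ⟨fun j => ?_, ?_⟩
    · have := h j
      by_cases hj : j = i
      · subst hj
        change α j ≤ β j
        simp only [Pi.add_apply, unitVec_self] at this; omega
      · simpa [Pi.add_apply, unitVec_ne hj] using this
    · have := h i
      simp only [Pi.add_apply, unitVec_self] at this; omega
  · rintro ⟨h, hi⟩ j
    by_cases hj : j = i
    · subst hj
      change α j + unitVec j j ≤ β j
      rw [unitVec_self]; omega
    · simpa [Pi.add_apply, unitVec_ne hj] using h j

theorem le_add_unitVec (α : Fin d → ℤ) (i : Fin d) : α ≤ α + unitVec i :=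
  (add_unitVec_le_iff.1 le_rfl).1

/-- Raising one coordinate that lies below `c` decreases `∑ i, (c i - α i)⁺`. -/
theorem sum_toNat_lt {c α β : Fin d → ℤ} (h : α ≤ β) {i : Fin d} (hi : α i < β i)
    (hc : α i < c i) : ∑ j, (c j - β j).toNat < ∑ j, (c j - α j).toNat := by
  refine Finset.sum_lt_sum (fun j _ => ?_) ⟨i, Finset.mem_univ i, ?_⟩
  · have : α j ≤ β j := h j
    omega
  · omega

/-- Induction along a lattice path of unit steps from `α` up to `β`. -/
theorem path_induction {α β : Fin d → ℤ} (hαβ : α ≤ β) {P : (Fin d → ℤ) → Prop} (h0 : P α)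
    (step : ∀ δ i, α ≤ δ → δ + unitVec i ≤ β → P δ → P (δ + unitVec i)) : P β := by
  induction h : ∑ j, (β j - α j).toNat using Nat.strong_induction_on generalizing β with
  | _ n ih =>
    by_cases heq : β = α
    · exact heq ▸ h0
    obtain ⟨i, hi⟩ : ∃ i, α i < β i := by
      by_contra! hc
      exact heq (le_antisymm hc hαβ)
    obtain ⟨β', rfl⟩ : ∃ β', β = β' + unitVec i := ⟨β - unitVec i, by simp⟩
    have hle : α ≤ β' := fun j => by
      have := hαβ j
      by_cases hj : j = i
      · subst hj
        change α j ≤ β' j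
        simp only [Pi.add_apply, unitVec_self] at hi; omega
      · simpa [Pi.add_apply, unitVec_ne hj] using this
    refine step β' i hle le_rfl (ih _ ?_ hle
      (fun δ j h1 h2 => step δ j h1 (h2.trans (le_add_unitVec β' i))) rfl)
    rw [← h]
    refine Finset.sum_lt_sum (fun j _ => ?_) ⟨i, Finset.mem_univ i, ?_⟩
    · have : β' j ≤ (β' + unitVec i) j := le_add_unitVec β' i j
      omega
    · have : α i ≤ β' i := hle i
      simp only [Pi.add_apply, unitVec_self]; omega

theorem eq_of_forall_add_unitVec_eq {g : (Fin d → ℤ) → ℤ}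
    (h : ∀ α i, g (α + unitVec i) = g α) (α β : Fin d → ℤ) : g α = g β := by
  have key : ∀ α β : Fin d → ℤ, α ≤ β → g β = g α := fun α β hαβ =>
    path_induction (P := fun δ => g δ = g α) hαβ rfl fun δ i _ _ hδ => (h δ i).trans hδ
  rw [key (α ⊓ β) α inf_le_left, key (α ⊓ β) β inf_le_right]

theorem exists_int_primitive (g : ℤ → ℤ) : ∃ F : ℤ → ℤ, ∀ n, F (n + 1) = F n + g n := by
  refine ⟨fun n => ∑ m ∈ Finset.Ico 0 n, g m - ∑ m ∈ Finset.Ico n 0, g m, fun n => ?_⟩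
  beta_reduce
  rcases le_or_gt 0 n with h | h
  · have h1 : Finset.Ico 0 (n + 1) = insert n (Finset.Ico 0 n) := by
      ext m; simp only [Finset.mem_Ico, Finset.mem_insert]; omega
    rw [h1, Finset.sum_insert (by simp), Finset.Ico_eq_empty_of_le (by omega : (0 : ℤ) ≤ n + 1),
      Finset.Ico_eq_empty_of_le h]
    simp only [Finset.sum_empty]; ring
  · have h1 : Finset.Ico n 0 = insert n (Finset.Ico (n + 1) 0) := by
      ext m; simp only [Finset.mem_Ico, Finset.mem_insert]; omega
    rw [h1, Finset.sum_insert (by simp), Finset.Ico_eq_empty_of_le (by omega : n + 1 ≤ 0),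
      Finset.Ico_eq_empty_of_le h.le]
    simp only [Finset.sum_empty]; ring

/-- A discrete closed `1`-form on `ℤ^d` is exact. -/
theorem exists_potential (τ : (Fin d → ℤ) → Fin d → ℤ)
    (hτ : ∀ α i j, i ≠ j → τ α i + τ (α + unitVec i) j = τ α j + τ (α + unitVec j) i) :
    ∃ f : (Fin d → ℤ) → ℤ, ∀ α i, f (α + unitVec i) = f α + τ α i := by
  suffices h : ∀ s : Finset (Fin d), ∃ f : (Fin d → ℤ) → ℤ,
      ∀ i ∈ s, ∀ α, f (α + unitVec i) = f α + τ α i by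
    obtain ⟨f, hf⟩ := h Finset.univ
    exact ⟨f, fun α i => hf i (Finset.mem_univ i) α⟩
  intro s
  induction s using Finset.induction_on with
  | empty => exact ⟨0, by simp⟩
  | insert j s hj ih =>
    obtain ⟨f, hf⟩ := ih
    -- the defect of `f` in direction `j` does not depend on the coordinates in `s`
    have hg : ∀ i ∈ s, ∀ α, τ (α + unitVec i) j - (f (α + unitVec i + unitVec j)
        - f (α + unitVec i)) = τ α j - (f (α + unitVec j) - f α) := by
      intro i hi α
      have h1 := hf i hi (α + unitVec j)
      have h2 := hf i hi α
      have h3 := hτ α i j (fun h => hj (h ▸ hi))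
      rw [add_right_comm] at h1
      rw [h1, h2]
      linarith
    let G : (Fin d → ℤ) → ℤ := fun α => τ α j - (f (α + unitVec j) - f α)
    choose F hF using exists_int_primitive
    refine ⟨fun α => f α + F (fun m => G (Function.update α j m)) (α j), fun i hi α => ?_⟩
    beta_reduce
    rcases Finset.mem_insert.1 hi with rfl | hi
    · have h1 : ∀ m, Function.update (α + unitVec i) i m = Function.update α i m := by
        intro m; ext k
        by_cases hk : k = i
        · subst hk; simp
        · simp [hk]
      have h2 : (α + unitVec i) i = α i + 1 := by simp
      simp only [h1, h2, hF, Function.update_eq_self]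
      simp only [G]
      ring
    · have hij : i ≠ j := fun h => hj (h ▸ hi)
      have h1 : ∀ m, Function.update (α + unitVec i) j m
          = Function.update α j m + unitVec i := by
        intro m; ext k
        by_cases hk : k = j
        · subst hk; simp [hij.symm]
        · simp [hk]
      have h2 : (α + unitVec i) j = α j := by simp [hij.symm]
      have h3 : ∀ m, G (Function.update α j m + unitVec i) = G (Function.update α j m) :=
        fun m => hg i hi _
      simp only [h1, h2, h3, hf i hi α]
      ring

/-! ### Good sets and their faces -/

/-- A set of vectors with the properties (G1) and (G2) of a good semigroup. -/
structure IsGoodSet (X : Set (Fin d → ℤ)) : Prop where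
  inf_mem : ∀ α ∈ X, ∀ β ∈ X, α ⊓ β ∈ X
  exists_gt : ∀ α ∈ X, ∀ β ∈ X, α ≠ β → ∀ i, α i = β i →
    ∃ ε ∈ X, α i < ε i ∧
      ∀ j, j ≠ i → min (α j) (β j) ≤ ε j ∧ (α j ≠ β j → ε j = min (α j) (β j))

/-- `X` has an element on the `i`-th face of the orthant with vertex `α`. For value sets of
modules this says that the colength of `{β ∈ X | α ≤ β}` increases by one when `α` is raised to
`α + unitVec i`. -/
def MeetsFace (X : Set (Fin d → ℤ)) (α : Fin d → ℤ) (i : Fin d) : Prop :=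
  ∃ β ∈ X, α ≤ β ∧ β i = α i

/-- The indicator of `MeetsFace`. -/
noncomputable def faceInd (X : Set (Fin d → ℤ)) (α : Fin d → ℤ) (i : Fin d) : ℤ := by
  classical exact if MeetsFace X α i then 1 else 0

theorem faceInd_of {X : Set (Fin d → ℤ)} {α : Fin d → ℤ} {i : Fin d} (h : MeetsFace X α i) :
    faceInd X α i = 1 := by simp [faceInd, h]

theorem faceInd_of_not {X : Set (Fin d → ℤ)} {α : Fin d → ℤ} {i : Fin d}
    (h : ¬ MeetsFace X α i) : faceInd X α i = 0 := by simp [faceInd, h]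

theorem meetsFace_of_mem {X : Set (Fin d → ℤ)} {α : Fin d → ℤ} (h : α ∈ X) (i : Fin d) :
    MeetsFace X α i := ⟨α, h, le_rfl, rfl⟩

theorem MeetsFace.mono {X Y : Set (Fin d → ℤ)} (hXY : X ⊆ Y) {α : Fin d → ℤ} {i : Fin d}
    (h : MeetsFace X α i) : MeetsFace Y α i := by
  obtain ⟨β, hβ, h⟩ := h
  exact ⟨β, hXY hβ, h⟩

theorem MeetsFace.of_le {X : Set (Fin d → ℤ)} {α α' : Fin d → ℤ} {i : Fin d}
    (h : MeetsFace X α' i) (hle : α ≤ α') (hi : α i = α' i) : MeetsFace X α i := by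
  obtain ⟨β, hβ, h1, h2⟩ := h
  exact ⟨β, hβ, hle.trans h1, h2.trans hi.symm⟩

theorem MeetsFace.of_add_unitVec {X : Set (Fin d → ℤ)} {α : Fin d → ℤ} {i j : Fin d}
    (hij : j ≠ i) (h : MeetsFace X (α + unitVec i) j) : MeetsFace X α j :=
  h.of_le (le_add_unitVec α i) (by simp [hij])

theorem MeetsFace.add_unitVec_of_not {X : Set (Fin d → ℤ)} {α : Fin d → ℤ} {i j : Fin d}
    (hij : j ≠ i) (h : MeetsFace X α j) (hi : ¬ MeetsFace X α i) :
    MeetsFace X (α + unitVec i) j := by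
  obtain ⟨β, hβ, h1, h2⟩ := h
  refine ⟨β, hβ, add_unitVec_le_iff.2 ⟨h1, lt_of_le_of_ne (h1 i) fun h => ?_⟩, ?_⟩
  · exact hi ⟨β, hβ, h1, h.symm⟩
  · simp [hij, h2]

theorem exists_forall_meetsFace {X : Set (Fin d → ℤ)}
    (hX : ∀ α ∈ X, ∀ β ∈ X, α ⊓ β ∈ X) {α : Fin d → ℤ} {J : Finset (Fin d)} (hJ : J.Nonempty)
    (h : ∀ j ∈ J, MeetsFace X α j) : ∃ β ∈ X, α ≤ β ∧ ∀ j ∈ J, β j = α j := by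
  induction hJ using Finset.Nonempty.cons_induction with
  | singleton j =>
    obtain ⟨β, hβ, h1, h2⟩ := h j (by simp)
    exact ⟨β, hβ, h1, by simpa using h2⟩
  | cons j s hj hs ih =>
    obtain ⟨β, hβ, h1, h2⟩ := h j (by simp)
    obtain ⟨ε, hε, h3, h4⟩ := ih fun k hk => h k (by simp [hk])
    refine ⟨β ⊓ ε, hX _ hβ _ hε, le_inf h1 h3, fun k hk => ?_⟩
    have e1 : α k ≤ β k := h1 k
    have e2 : α k ≤ ε k := h3 k
    rw [Pi.inf_apply]
    rcases Finset.mem_cons.1 hk with rfl | hk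
    · rw [h2]; exact inf_eq_left.2 e2
    · rw [h4 k hk]; exact inf_eq_right.2 e1

theorem mem_of_forall_meetsFace (hd : 1 ≤ d) {X : Set (Fin d → ℤ)}
    (hX : ∀ α ∈ X, ∀ β ∈ X, α ⊓ β ∈ X) {α : Fin d → ℤ} (h : ∀ i, MeetsFace X α i) : α ∈ X := by
  have : Nonempty (Fin d) := ⟨⟨0, hd⟩⟩
  obtain ⟨β, hβ, _, h2⟩ := exists_forall_meetsFace hX Finset.univ_nonempty fun j _ => h j
  have : β = α := funext fun j => h2 j (Finset.mem_univ j)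
  exact this ▸ hβ

/-- Property (G2) as an exchange property of faces. -/
theorem MeetsFace.exchange {X : Set (Fin d → ℤ)} (hX : IsGoodSet X) {α : Fin d → ℤ} {i j : Fin d}
    (hij : i ≠ j) (h1 : MeetsFace X α i) (h2 : MeetsFace X (α + unitVec i) j) :
    MeetsFace X (α + unitVec j) i := by
  obtain ⟨ε, hε, hε1, hε2⟩ := h1
  obtain ⟨β, hβ, hβ1, hβ2⟩ := h2
  rw [add_unitVec_le_iff] at hβ1
  have hβ2' : β j = α j := by simpa [hij.symm] using hβ2
  have goal_of : ∀ ρ ∈ X, α ≤ ρ → α j < ρ j → ρ i = α i → MeetsFace X (α + unitVec j) i :=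
    fun ρ hρ a b c => ⟨ρ, hρ, add_unitVec_le_iff.2 ⟨a, b⟩, by simp [hij, c]⟩
  have hεj : α j ≤ ε j := hε1 j
  rcases hεj.lt_or_eq with hlt | heq
  · exact goal_of ε hε hε1 hlt hε2
  have hne : ε ≠ β := by
    rintro rfl
    have := hβ1.2
    omega
  obtain ⟨ρ, hρ, hρ1, hρ2⟩ := hX.exists_gt ε hε β hβ hne j (by omega)
  refine goal_of ρ hρ (fun k => ?_) (by omega) ?_
  · by_cases hk : k = j
    · subst hk; exact heq.le.trans hρ1.le
    · exact (le_min (hε1 k) (hβ1.1 k)).trans (hρ2 k hk).1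
  · have := (hρ2 i hij).2 (by have := hβ1.2; omega)
    rw [this, hε2]
    exact min_eq_left hβ1.2.le

theorem faceInd_closed {X : Set (Fin d → ℤ)} (hX : IsGoodSet X) (α : Fin d → ℤ) {i j : Fin d}
    (hij : i ≠ j) : faceInd X α i + faceInd X (α + unitVec i) j
      = faceInd X α j + faceInd X (α + unitVec j) i := by
  classical
  have a1 : MeetsFace X (α + unitVec i) j → MeetsFace X α j :=
    MeetsFace.of_add_unitVec hij.symm
  have a2 : MeetsFace X (α + unitVec j) i → MeetsFace X α i := MeetsFace.of_add_unitVec hij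
  have a3 : MeetsFace X α j → ¬ MeetsFace X α i → MeetsFace X (α + unitVec i) j :=
    fun h => h.add_unitVec_of_not hij.symm
  have a4 : MeetsFace X α i → ¬ MeetsFace X α j → MeetsFace X (α + unitVec j) i :=
    fun h => h.add_unitVec_of_not hij
  have a5 := MeetsFace.exchange hX (α := α) hij
  have a6 := MeetsFace.exchange hX (α := α) hij.symm
  by_cases b1 : MeetsFace X α i <;> by_cases b2 : MeetsFace X α j <;>
    by_cases b3 : MeetsFace X (α + unitVec i) j <;>
    by_cases b4 : MeetsFace X (α + unitVec j) i <;> simp_all [faceInd]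

/-- The converse of `MeetsFace.exchange`, for sets closed under infima. -/
theorem isGoodSet_of_exchange {X : Set (Fin d → ℤ)} (hX : ∀ α ∈ X, ∀ β ∈ X, α ⊓ β ∈ X)
    (hex : ∀ α i j, i ≠ j → MeetsFace X α i → MeetsFace X (α + unitVec i) j →
      MeetsFace X (α + unitVec j) i) : IsGoodSet X := by
  refine ⟨hX, fun α hα β hβ hne i hi => ?_⟩
  have hJ : (Finset.univ.filter fun j => α j ≠ β j).Nonempty := by
    obtain ⟨j, hj⟩ := Function.ne_iff.1 hne
    exact ⟨j, by simp [hj]⟩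
  have key : ∀ α ∈ X, ∀ β ∈ X, α i = β i → ∀ j, α j < β j →
      MeetsFace X (α ⊓ β + unitVec i) j := by
    intro α hα β hβ hi j hj
    have hji : j ≠ i := by rintro rfl; omega
    refine hex _ j i hji ⟨α, hα, inf_le_left, ?_⟩ ⟨β, hβ, ?_, ?_⟩
    · exact (inf_eq_left.2 hj.le).symm
    · refine add_unitVec_le_iff.2 ⟨inf_le_right, ?_⟩
      rw [Pi.inf_apply, inf_eq_left.2 hj.le]; exact hj
    · simp [hi, hji.symm]
  obtain ⟨ε, hε, h1, h2⟩ := exists_forall_meetsFace hX (α := α ⊓ β + unitVec i) hJ (by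
    intro j hj
    rcases lt_or_gt_of_ne (Finset.mem_filter.1 hj).2 with h | h
    · exact key α hα β hβ hi j h
    · rw [inf_comm]; exact key β hβ α hα hi.symm j h)
  rw [add_unitVec_le_iff] at h1
  refine ⟨ε, hε, ?_, fun j hj => ⟨h1.1 j, fun hne => ?_⟩⟩
  · have := h1.2
    rwa [Pi.inf_apply, ← hi, inf_idem] at this
  · have := h2 j (by simpa using hne)
    simpa [hj] using this

/-- In a set of nonnegative vectors closed under infima, the elements above `δ` have a least
element if there is one at all. -/
theorem exists_isLeast_above {X : Set (Fin d → ℤ)} (hX : ∀ α ∈ X, ∀ β ∈ X, α ⊓ β ∈ X)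
    (δ : Fin d → ℤ) (hne : ∃ β ∈ X, δ ≤ β) : ∃ μ, IsLeast {β | β ∈ X ∧ δ ≤ β} μ := by
  obtain ⟨β, hβ, hδβ⟩ := hne
  induction h : ∑ j, (β j - δ j).toNat using Nat.strong_induction_on generalizing β with
  | _ n ih =>
    by_cases hl : ∀ ε ∈ X, δ ≤ ε → β ≤ ε
    · exact ⟨β, ⟨hβ, hδβ⟩, fun ε hε => hl ε hε.1 hε.2⟩
    push Not at hl
    obtain ⟨ε, hε, h1, h2⟩ := hl
    refine ih _ ?_ (β ⊓ ε) (hX _ hβ _ hε) (le_inf hδβ h1) rfl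
    obtain ⟨i, hi⟩ : ∃ i, ε i < β i := by
      by_contra! hc
      exact h2 hc
    rw [← h]
    refine Finset.sum_lt_sum (fun j _ => ?_) ⟨i, Finset.mem_univ i, ?_⟩
    · have : (β ⊓ ε) j ≤ β j := inf_le_left
      omega
    · have : (β ⊓ ε) i ≤ ε i := inf_le_right
      have : δ i ≤ ε i := h1 i
      omega

/-! ### The dual of a good set -/

/-- The dual of `X` with respect to `γ`. For a good semigroup `S` with `γ = gam S` it is the
canonical ideal of `S`. -/
def dualSet (X : Set (Fin d → ℤ)) (γ : Fin d → ℤ) : Set (Fin d → ℤ) :=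
  {α | delta X (γ - α) = ∅}

theorem mem_delta {X : Set (Fin d → ℤ)} {α β : Fin d → ℤ} :
    β ∈ delta X α ↔ β ∈ X ∧ ∃ i, β i = α i ∧ ∀ j, j ≠ i → α j < β j := by
  simp only [delta, deltaSet, Set.mem_iUnion, Set.mem_ofPred_eq, Finset.mem_singleton]
  constructor
  · rintro ⟨i, h, h1, h2⟩
    exact ⟨h, i, h1 i rfl, h2⟩
  · rintro ⟨h, i, h1, h2⟩
    exact ⟨i, h, fun j hj => hj ▸ h1, h2⟩

theorem le_of_mem_delta {X : Set (Fin d → ℤ)} {α β : Fin d → ℤ} (h : β ∈ delta X α) :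
    α ≤ β := by
  obtain ⟨_, i, h1, h2⟩ := mem_delta.1 h
  intro j
  by_cases hj : j = i
  · subst hj; exact h1.ge
  · exact (h2 j hj).le

/-- The relation `β ∈ Δ(γ - α)` says that `α + β ∈ Δ(γ)`. -/
theorem mem_delta_sub {X : Set (Fin d → ℤ)} {γ α β : Fin d → ℤ} :
    β ∈ delta X (γ - α) ↔ β ∈ X ∧ α + β ∈ delta Set.univ γ := by
  simp only [mem_delta, Set.mem_univ, true_and, Pi.add_apply, Pi.sub_apply]
  refine and_congr_right fun _ => exists_congr fun i => and_congr ?_ (forall_congr' fun j =>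
    imp_congr_right fun _ => ?_) <;> constructor <;> intro h <;> omega

theorem mem_dualSet {X : Set (Fin d → ℤ)} {γ α : Fin d → ℤ} :
    α ∈ dualSet X γ ↔ ∀ β ∈ X, α + β ∉ delta Set.univ γ := by
  simp only [dualSet, Set.mem_ofPred_eq, Set.eq_empty_iff_forall_notMem, mem_delta_sub, not_and]

theorem meetsFace_delta {X : Set (Fin d → ℤ)} {γ α : Fin d → ℤ} {i : Fin d} :
    MeetsFace X (γ + 1 - α - unitVec i) i ↔
      ∃ β ∈ X, α i + β i = γ i ∧ ∀ j, j ≠ i → γ j < α j + β j := by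
  refine exists_congr fun β => and_congr_right fun _ => ?_
  have hi : (γ + 1 - α - unitVec i) i = γ i - α i := by simp; ring
  constructor
  · rintro ⟨h1, h2⟩
    refine ⟨by omega, fun j hj => ?_⟩
    have := h1 j
    simp only [Pi.add_apply, Pi.sub_apply, unitVec_ne hj, Pi.one_apply] at this
    omega
  · rintro ⟨h1, h2⟩
    refine ⟨fun j => ?_, by omega⟩
    by_cases hj : j = i
    · subst hj; exact hi.le.trans (by omega)
    · have := h2 j hj
      change γ j + 1 - α j - unitVec i j ≤ β j
      rw [unitVec_ne hj]; omega

theorem dualSet_inf_mem {X : Set (Fin d → ℤ)} {γ α β : Fin d → ℤ} (hα : α ∈ dualSet X γ)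
    (hβ : β ∈ dualSet X γ) : α ⊓ β ∈ dualSet X γ := by
  have key : ∀ α ∈ dualSet X γ, ∀ β : Fin d → ℤ, ∀ ε ∈ X, ∀ i, α i ≤ β i →
      (α ⊓ β) i + ε i = γ i → (∀ j, j ≠ i → γ j < (α ⊓ β) j + ε j) → False := by
    intro α hα β ε hε i hi h1 h2
    refine mem_dualSet.1 hα ε hε (mem_delta.2 ⟨trivial, i, ?_, fun j hj => ?_⟩)
    · rw [Pi.inf_apply, inf_eq_left.2 hi] at h1; exact h1
    · have := h2 j hj
      have h3 : (α ⊓ β) j ≤ α j := inf_le_left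
      rw [Pi.add_apply]; omega
  rw [mem_dualSet]
  intro ε hε h
  obtain ⟨_, i, h1, h2⟩ := mem_delta.1 h
  rcases le_total (α i) (β i) with hi | hi
  · exact key α hα β ε hε i hi h1 h2
  · rw [inf_comm] at h1 h2
    exact key β hβ α ε hε i hi h1 h2

/-- The faces of the dual of a good set are complementary to those of the set itself. -/
theorem meetsFace_dualSet {X : Set (Fin d → ℤ)} (hX : IsGoodSet X) (hX0 : ∀ α ∈ X, 0 ≤ α)
    (γ α : Fin d → ℤ) (i : Fin d) :
    MeetsFace (dualSet X γ) α i ↔ ¬ MeetsFace X (γ + 1 - α - unitVec i) i := by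
  constructor
  · rintro ⟨β, hβ, h1, h2⟩ h
    obtain ⟨ε, hε, h3, h4⟩ := meetsFace_delta.1 h
    refine mem_dualSet.1 hβ ε hε (mem_delta.2 ⟨trivial, i, ?_, fun j hj => ?_⟩)
    · rw [Pi.add_apply]; omega
    · have := h4 j hj
      have h5 : α j ≤ β j := h1 j
      rw [Pi.add_apply]; omega
  · intro h
    induction hn : ∑ j, (γ j + 1 - α j).toNat using Nat.strong_induction_on generalizing α with
    | _ n ih =>
      by_cases hex : ∃ j, j ≠ i ∧ α j ≤ γ j ∧
          ¬ MeetsFace X (γ + 1 - (α + unitVec j) - unitVec i) i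
      · -- raise `α` in a coordinate other than `i` as long as the face of `X` stays empty
        obtain ⟨j, hj, h1, h2⟩ := hex
        refine (ih _ ?_ _ h2 rfl).of_add_unitVec hj.symm
        rw [← hn]
        exact sum_toNat_lt (c := γ + 1) (le_add_unitVec α j) (i := j) (by simp)
          (by simp only [Pi.add_apply, Pi.one_apply]; omega)
      · -- no raise is possible: by (G2), `α` itself belongs to the dual
        push Not at hex
        refine meetsFace_of_mem (mem_dualSet.2 fun ε hε hmem => ?_) i
        obtain ⟨_, j, h1, h2⟩ := mem_delta.1 hmem
        simp only [Pi.add_apply] at h1 h2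
        by_cases hj : j = i
        · subst hj; exact h (meetsFace_delta.2 ⟨ε, hε, h1, h2⟩)
        have hεj : 0 ≤ ε j := hX0 ε hε j
        have hf := hex j hj (by omega)
        have e1 : γ + 1 - (α + unitVec j) - unitVec i
          = γ + 1 - α - unitVec i - unitVec j := by ring
        have e2 : γ + 1 - α - unitVec i = γ + 1 - α - unitVec i - unitVec j + unitVec j := by ring
        rw [e1] at hf
        rw [e2] at h
        refine h (hf.exchange hX (Ne.symm hj) ⟨ε, hε, fun k => ?_, ?_⟩)
        · change γ k + 1 - α k - unitVec i k - unitVec j k + unitVec i k ≤ ε k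
          by_cases hk : k = j
          · subst hk; rw [unitVec_self]; omega
          · have := h2 k hk
            rw [unitVec_ne hk]; omega
        · simp; omega

theorem isGoodSet_dualSet {X : Set (Fin d → ℤ)} (hX : IsGoodSet X) (hX0 : ∀ α ∈ X, 0 ≤ α)
    (γ : Fin d → ℤ) : IsGoodSet (dualSet X γ) := by
  refine isGoodSet_of_exchange (fun α hα β hβ => dualSet_inf_mem hα hβ) fun α i j hij h1 h2 => ?_
  rw [meetsFace_dualSet hX hX0] at h1 h2 ⊢
  intro h
  have e1 : γ + 1 - (α + unitVec j) - unitVec i = γ + 1 - α - unitVec i - unitVec j := by ring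
  have e2 : γ + 1 - (α + unitVec i) - unitVec j = γ + 1 - α - unitVec i - unitVec j := by ring
  rw [e1] at h
  rw [e2] at h2
  have := h.add_unitVec_of_not hij h2
  rw [sub_add_cancel] at this
  exact h1 this

/-! ### The colength function of a pair of good sets -/

/-- `f` is the colength function of a good subset `E` of a good set `T`, both containing
`c + ℕ^d`: for value sets of modules, `f α` is the length of the quotient of
`{β ∈ T | α ≤ β}` by `{β ∈ E | α ≤ β}`. -/
structure IsColength (T E : Set (Fin d → ℤ)) (c : Fin d → ℤ) (f : (Fin d → ℤ) → ℤ) : Prop where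
  good : IsGoodSet T
  subset : E ⊆ T
  exists_face : ∀ α, α ∉ E → ∃ i, ¬ MeetsFace E α i
  step : ∀ α i, f α = f (α + unitVec i) + faceInd T α i - faceInd E α i
  conductor : ∀ α, c ≤ α → α ∈ E
  zero : ∀ α, c ≤ α → f α = 0

theorem exists_isColength (hd : 1 ≤ d) {T E : Set (Fin d → ℤ)} (hT : IsGoodSet T)
    (hE : IsGoodSet E) (hET : E ⊆ T) {c : Fin d → ℤ} (hc : ∀ α, c ≤ α → α ∈ E) :
    ∃ f, IsColength T E c f := by
  obtain ⟨f, hf⟩ := exists_potential (fun α i => faceInd E α i - faceInd T α i) (by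
    intro α i j hij
    have h1 := faceInd_closed hT α hij
    have h2 := faceInd_closed hE α hij
    linarith)
  refine ⟨fun α => f α - f c, hT, hET, fun α hα => ?_, fun α i => ?_, hc, fun α hα => ?_⟩
  · by_contra! h
    exact hα (mem_of_forall_meetsFace hd hE.inf_mem h)
  · have := hf α i
    linarith
  · refine path_induction (P := fun δ => f δ - f c = 0) hα (sub_self _) fun δ i hδ _ h => ?_
    have h1 := hf δ i
    rw [faceInd_of (meetsFace_of_mem (hc δ hδ) i),
      faceInd_of (meetsFace_of_mem (hET (hc δ hδ)) i)] at h1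
    linarith

namespace IsColength

variable {T E : Set (Fin d → ℤ)} {c : Fin d → ℤ} {f : (Fin d → ℤ) → ℤ}

theorem add_unitVec_of_meets (h : IsColength T E c f) {α : Fin d → ℤ} {i : Fin d}
    (hE : MeetsFace E α i) : f (α + unitVec i) = f α := by
  have := h.step α i
  rw [faceInd_of hE, faceInd_of (hE.mono h.subset)] at this
  linarith

theorem add_unitVec_of_not (h : IsColength T E c f) {α : Fin d → ℤ} {i : Fin d}
    (hT : ¬ MeetsFace T α i) : f (α + unitVec i) = f α := by
  have := h.step α i
  rw [faceInd_of_not hT, faceInd_of_not fun hE => hT (hE.mono h.subset)] at this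
  linarith

theorem add_unitVec_drop (h : IsColength T E c f) {α : Fin d → ℤ} {i : Fin d}
    (hT : MeetsFace T α i) (hE : ¬ MeetsFace E α i) : f α = f (α + unitVec i) + 1 := by
  have := h.step α i
  rw [faceInd_of hT, faceInd_of_not hE] at this
  linarith

theorem add_unitVec_le (h : IsColength T E c f) (α : Fin d → ℤ) (i : Fin d) :
    f (α + unitVec i) ≤ f α ∧ f α ≤ f (α + unitVec i) + 1 := by
  by_cases hT : MeetsFace T α i
  · by_cases hE : MeetsFace E α i
    · have := h.add_unitVec_of_meets hE; omega
    · have := h.add_unitVec_drop hT hE; omega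
  · have := h.add_unitVec_of_not hT; omega

theorem antitone (h : IsColength T E c f) {α β : Fin d → ℤ} (hαβ : α ≤ β) : f β ≤ f α :=
  path_induction (P := fun δ => f δ ≤ f α) hαβ le_rfl fun δ i _ _ hδ =>
    (h.add_unitVec_le δ i).1.trans hδ

theorem nonneg (h : IsColength T E c f) (α : Fin d → ℤ) : 0 ≤ f α := by
  have := h.antitone (le_sup_left : α ≤ α ⊔ c)
  rwa [h.zero _ le_sup_right] at this

theorem pos (h : IsColength T E c f) {α : Fin d → ℤ} (hα : α ∈ T) (hE : α ∉ E) : 1 ≤ f α := by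
  obtain ⟨i, hi⟩ := h.exists_face α hE
  have h1 := h.add_unitVec_drop (meetsFace_of_mem hα i) hi
  have h2 := h.nonneg (α + unitVec i)
  omega

/-- Passing to the least element of `T` above `δ` does not change the colength. -/
theorem exists_least (h : IsColength T E c f) (δ : Fin d → ℤ) :
    ∃ μ, IsLeast {β | β ∈ T ∧ δ ≤ β} μ ∧ f μ = f δ := by
  obtain ⟨μ, hμ⟩ := exists_isLeast_above h.good.inf_mem δ
    ⟨δ ⊔ c, h.subset (h.conductor _ le_sup_right), le_sup_left⟩
  refine ⟨μ, hμ, path_induction (P := fun β => f β = f δ) hμ.1.2 rfl fun β i h1 h2 h3 => ?_⟩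
  refine (h.add_unitVec_of_not ?_).trans h3
  rintro ⟨ε, hε, h4, h5⟩
  have h6 : μ i ≤ ε i := hμ.2 ⟨hε, h1.trans h4⟩ i
  have h7 := (add_unitVec_le_iff.1 h2).2
  omega

/-- Above an element of positive colength there is an element of `T \ E` with the same
colength. -/
theorem exists_above (h : IsColength T E c f) {δ : Fin d → ℤ} (hδ : δ ∈ T) (hf : 1 ≤ f δ) :
    ∃ β ∈ T \ E, δ ≤ β ∧ f β = f δ := by
  induction hn : ∑ j, (c j - δ j).toNat using Nat.strong_induction_on generalizing δ with
  | _ n ih =>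
    by_cases hE : δ ∈ E
    · obtain ⟨i, hi⟩ : ∃ i, δ i < c i := by
        by_contra! hc
        rw [h.zero δ hc] at hf
        omega
      obtain ⟨μ, hμ, hfμ⟩ := h.exists_least (δ + unitVec i)
      rw [h.add_unitVec_of_meets (meetsFace_of_mem hE i)] at hfμ
      have hle := add_unitVec_le_iff.1 hμ.1.2
      obtain ⟨β, hβ, h1, h2⟩ := ih _ (hn ▸ sum_toNat_lt hle.1 hle.2 hi) hμ.1.1 (by omega) rfl
      exact ⟨β, hβ, hle.1.trans h1, h2.trans hfμ⟩
    · exact ⟨δ, ⟨hδ, hE⟩, le_rfl, rfl⟩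

/-- An element of `T \ E` has smaller colength than `α` once it exceeds `α` in a coordinate
whose face at `α` is missed by `E`. -/
theorem lt_of_missed (h : IsColength T E c f) {α β : Fin d → ℤ} {i : Fin d} (hα : α ∈ T)
    (hi : ¬ MeetsFace E α i) (hle : α ≤ β) (hlt : α i < β i) : f β < f α := by
  have h1 := h.add_unitVec_drop (meetsFace_of_mem hα i) hi
  have h2 := h.antitone (add_unitVec_le_iff.2 ⟨hle, hlt⟩)
  omega

theorem lt_of_dominated (h : IsColength T E c f) {α β : Fin d → ℤ} (hα : α ∈ T \ E)
    (hαβ : Dominated α β) : f β < f α := by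
  obtain ⟨i, hi⟩ := h.exists_face α hα.2
  exact h.lt_of_missed hα.1 hi (fun j => (hαβ j).le) (hαβ i)

theorem not_isCompleteInf (h : IsColength T E c f) {α : Fin d → ℤ} (hα : α ∈ T \ E)
    {B : Set (Fin d → ℤ)} (hB : ∀ β ∈ B, f α ≤ f β) : ¬ IsCompleteInf B α := by
  rintro ⟨r, _, _, β, F, h1, _, h3⟩
  obtain ⟨i, hi⟩ := h.exists_face α hα.2
  obtain ⟨k, hk⟩ := h3 i
  obtain ⟨hβ, h4, h5⟩ := (h1 k).2.2
  have hle : α ≤ β k := fun j => by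
    by_cases hj : j ∈ F k
    · exact (h4 j hj).ge
    · exact (h5 j hj).le
  have := h.lt_of_missed hα.1 hi hle (h5 i hk)
  have := hB _ hβ
  omega

end IsColength

/-! ### Levels as fibres of the colength function -/

/-- The coordinates in which `β` and `α` differ. -/
def diffSet (α β : Fin d → ℤ) : Finset (Fin d) := Finset.univ.filter fun i => β i ≠ α i

theorem mem_diffSet {α β : Fin d → ℤ} {i : Fin d} : i ∈ diffSet α β ↔ β i ≠ α i := by
  simp [diffSet]

/-- A partition of the coordinates into at least two blocks, each of which is the support of
`β - α` for some `β ≥ α` in `B`, exhibits `α` as a complete infimum. -/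
theorem isCompleteInf_of_partition {B : Set (Fin d → ℤ)} {α : Fin d → ℤ}
    (P : Finset (Finset (Fin d))) (h1 : 1 < P.card) (hne : ∀ G ∈ P, G.Nonempty)
    (hdisj : ∀ G ∈ P, ∀ G' ∈ P, G ≠ G' → Disjoint G G') (hcov : ∀ i, ∃ G ∈ P, i ∈ G)
    (hB : ∀ G ∈ P, ∃ β ∈ B, α ≤ β ∧ diffSet α β = G) : IsCompleteInf B α := by
  choose! b hb using hB
  have : Nonempty (Fin d) := by
    obtain ⟨G, hG, _⟩ := Finset.one_lt_card.1 h1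
    exact ⟨(hne G hG).choose⟩
  choose! p hp using hne
  have hpinj : Set.InjOn p P := by
    intro G hG G' hG' heq
    by_contra hne
    exact Finset.disjoint_left.1 (hdisj G hG G' hG' hne) (hp G hG) (heq ▸ hp G' hG')
  have hcard : P.card ≤ d := by
    have := Finset.card_le_card_of_injOn (t := Finset.univ) p (by simp) hpinj
    simpa using this
  let e := P.equivFin.symm
  refine ⟨P.card, h1, hcard, fun k => b (e k), fun k => (e k : Finset (Fin d))ᶜ, fun k => ?_,
    fun j k hjk => ?_, fun i => ?_⟩
  · obtain ⟨hbB, hle, hd⟩ := hb _ (e k).2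
    refine ⟨?_, ?_, hbB, fun i hi => ?_, fun i hi => ?_⟩
    · obtain ⟨G, hG, hGk⟩ := Finset.exists_mem_ne h1 (e k : Finset (Fin d))
      exact ⟨p G, Finset.mem_compl.2 (Finset.disjoint_left.1 (hdisj G hG _ (e k).2 hGk) (hp G hG))⟩
    · intro h
      have := Finset.mem_univ (p (e k))
      rw [← h, Finset.mem_compl] at this
      exact this (hp _ (e k).2)
    · rw [Finset.mem_compl, ← hd, mem_diffSet, not_not] at hi
      exact hi
    · rw [Finset.mem_compl, not_not, ← hd, mem_diffSet] at hi
      exact lt_of_le_of_ne (hle i) (Ne.symm hi)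
  · obtain ⟨_, hle, hd⟩ := hb _ (e j).2
    obtain ⟨_, hle', hd'⟩ := hb _ (e k).2
    have hdis := hdisj _ (e j).2 _ (e k).2 fun h => hjk (e.injective (Subtype.ext h))
    refine le_antisymm (le_inf hle hle') fun i => ?_
    rw [Pi.inf_apply]
    by_cases hi : i ∈ (e j : Finset (Fin d))
    · have := Finset.disjoint_left.1 hdis hi
      rw [← hd', mem_diffSet, not_not] at this
      exact inf_le_right.trans this.le
    · rw [← hd, mem_diffSet, not_not] at hi
      exact inf_le_left.trans hi.le
  · obtain ⟨G, hG, hi⟩ := hcov i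
    refine ⟨P.equivFin ⟨G, hG⟩, ?_⟩
    simpa [e] using hi

/-- If `α` has colength at least `k + 2` and is not dominated by an element of colength at least
`k + 1`, then it is a complete infimum of such elements: the least elements `μ i` of `T` with
`μ i ≥ α` and `μ i i > α i` cut out a partition of the coordinates, and the block of a coordinate
whose face at `α` is missed by `E` can be enlarged so that every block comes from `T \ E`. -/
theorem IsColength.isCompleteInf {T E : Set (Fin d → ℤ)} {c : Fin d → ℤ}
    {f : (Fin d → ℤ) → ℤ} (h : IsColength T E c f) {α : Fin d → ℤ} (hα : α ∈ T \ E) {k : ℕ}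
    (hk : (k : ℤ) + 1 < f α)
    (hdom : ∀ β ∈ T \ E, (k : ℤ) < f β → ¬ Dominated α β) :
    IsCompleteInf {β | β ∈ T \ E ∧ (k : ℤ) < f β} α := by
  choose μ hμ hfμ using fun i => h.exists_least (α + unitVec i)
  have hle : ∀ i, α ≤ μ i := fun i => (add_unitVec_le_iff.1 (hμ i).1.2).1
  have hself : ∀ i, α i < μ i i := fun i => (add_unitVec_le_iff.1 (hμ i).1.2).2
  have hmin : ∀ i, ∀ β ∈ T, α ≤ β → α i < β i → μ i ≤ β := fun i β hβ h1 h2 =>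
    (hμ i).2 ⟨hβ, add_unitVec_le_iff.2 ⟨h1, h2⟩⟩
  have hf : ∀ i, (k : ℤ) < f (μ i) := fun i => by
    have := (h.add_unitVec_le α i).2
    rw [hfμ i]; omega
  have hlt : ∀ {β : Fin d → ℤ} {i}, α ≤ β → (i ∈ diffSet α β ↔ α i < β i) := by
    intro β i h1
    rw [mem_diffSet]
    exact ⟨fun h2 => lt_of_le_of_ne (h1 i) (Ne.symm h2), fun h2 => h2.ne'⟩
  -- a support that contains `i` contains the support of `μ i - α`
  have hblock : ∀ {β : Fin d → ℤ} {i}, β ∈ T → α ≤ β → i ∈ diffSet α β →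
      diffSet α (μ i) ⊆ diffSet α β := by
    intro β i hβ h1 hi j hj
    rw [hlt h1] at hi ⊢
    rw [hlt (hle i)] at hj
    exact hj.trans_le (hmin i β hβ h1 hi j)
  -- by (G2), lying in a common block is a symmetric relation
  have hsymm : ∀ {i j}, j ∈ diffSet α (μ i) → i ∈ diffSet α (μ j) := by
    intro i j hj
    by_contra hi
    rw [mem_diffSet, not_not] at hi
    obtain ⟨ρ, hρ, h1, h2⟩ := h.good.exists_gt α hα.1 (μ j) (hμ j).1.1
      (fun h => (hself j).ne (congrFun h j)) i hi.symm
    have hij : j ≠ i := by rintro rfl; exact (hself j).ne' hi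
    have hαρ : α ≤ ρ := fun l => by
      by_cases hl : l = i
      · subst hl; exact h1.le
      · exact (le_min le_rfl (hle j l)).trans (h2 l hl).1
    have h3 := (h2 j hij).2 (hself j).ne
    rw [min_eq_left (hself j).le] at h3
    rw [hlt (hle i)] at hj
    have h4 : μ i j ≤ ρ j := hmin i ρ hρ hαρ h1 j
    omega
  obtain ⟨i, hi⟩ := h.exists_face α hα.2
  obtain ⟨β, hβ, hμβ, hfβ⟩ := h.exists_above (hμ i).1.1 (by have := hf i; omega)
  have hαβ : α ≤ β := (hle i).trans hμβ
  have hiβ : i ∈ diffSet α β := (hlt hαβ).2 ((hself i).trans_le (hμβ i))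
  obtain ⟨j, hj⟩ : ∃ j, j ∉ diffSet α β := by
    by_contra! hall
    exact hdom β hβ (hfβ ▸ hf i) fun j => (hlt hαβ).1 (hall j)
  have hdis : ∀ {j l}, j ∉ diffSet α β → l ∈ diffSet α (μ j) → l ∉ diffSet α β :=
    fun hj hl hl' => hj (hblock hβ.1 hαβ hl' (hsymm hl))
  let P : Finset (Finset (Fin d)) :=
    insert (diffSet α β) ((diffSet α β)ᶜ.image fun j => diffSet α (μ j))
  have hP : ∀ {G}, G ∈ P ↔ G = diffSet α β ∨ ∃ j, j ∉ diffSet α β ∧ diffSet α (μ j) = G := by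
    simp [P]
  have hin : ∀ j, j ∈ diffSet α (μ j) := fun j => (hlt (hle j)).2 (hself j)
  refine isCompleteInf_of_partition P ?_ ?_ ?_ ?_ ?_
  · refine Finset.one_lt_card.2 ⟨_, hP.2 (Or.inl rfl), _, hP.2 (Or.inr ⟨j, hj, rfl⟩), fun heq => ?_⟩
    exact hj (heq ▸ hin j)
  · intro G hG
    rcases hP.1 hG with rfl | ⟨j, _, rfl⟩
    · exact ⟨i, hiβ⟩
    · exact ⟨j, hin j⟩
  · intro G hG G' hG' hne
    rw [Finset.disjoint_left]
    intro l hl hl'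
    rcases hP.1 hG with rfl | ⟨j, hj, rfl⟩ <;> rcases hP.1 hG' with rfl | ⟨j', hj', rfl⟩
    · exact hne rfl
    · exact hdis hj' hl' hl
    · exact hdis hj hl hl'
    · have hsub : ∀ {j l}, l ∈ diffSet α (μ j) → diffSet α (μ j) = diffSet α (μ l) := fun {j l} h1 =>
        (hblock (hμ l).1.1 (hle l) (hsymm h1)).antisymm (hblock (hμ j).1.1 (hle j) h1)
      exact hne ((hsub hl).trans (hsub hl').symm)
  · intro l
    by_cases hl : l ∈ diffSet α β
    · exact ⟨_, hP.2 (Or.inl rfl), hl⟩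
    · exact ⟨_, hP.2 (Or.inr ⟨l, hl, rfl⟩), hin l⟩
  · intro G hG
    rcases hP.1 hG with rfl | ⟨j, hj, rfl⟩
    · exact ⟨β, ⟨hβ, hfβ ▸ hf i⟩, hαβ, rfl⟩
    · refine ⟨μ j, ⟨⟨(hμ j).1.1, fun hE => hi ⟨μ j, hE, hle j, ?_⟩⟩, hf j⟩, hle j, rfl⟩
      by_contra hne
      exact hdis hj (mem_diffSet.2 hne) hiβ

theorem IsColength.topLayer_eq {T E : Set (Fin d → ℤ)} {c : Fin d → ℤ}
    {f : (Fin d → ℤ) → ℤ} (h : IsColength T E c f) (k : ℕ) :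
    topLayer {α | α ∈ T \ E ∧ (k : ℤ) < f α} = {α | α ∈ T \ E ∧ f α = k + 1} := by
  ext α
  constructor
  · rintro ⟨⟨⟨hα, hk⟩, hmax⟩, hinf⟩
    refine ⟨hα, ?_⟩
    by_contra hne
    refine hinf ?_
    obtain ⟨r, h1, h2, β, F, h3, h4⟩ := h.isCompleteInf hα (k := k) (by omega)
      fun β hβ hfβ => hmax β ⟨hβ, hfβ⟩
    refine ⟨r, h1, h2, β, F, fun l => ?_, h4⟩
    obtain ⟨h5, h6, h7, h8, h9⟩ := h3 l
    -- elements above the maximal element `α` are maximal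
    refine ⟨h5, h6, ⟨h7, fun ρ hρ hdom => hmax ρ hρ fun i => ?_⟩, h8, h9⟩
    by_cases hi : i ∈ F l
    · exact (h8 i hi) ▸ hdom i
    · exact (h9 i hi).trans (hdom i)
  · rintro ⟨hα, hk⟩
    refine ⟨⟨⟨hα, by omega⟩, fun β hβ hdom => ?_⟩, h.not_isCompleteInf hα fun β hβ => ?_⟩
    · have := h.lt_of_dominated hα hdom
      have := hβ.2
      omega
    · have := hβ.1.2
      omega

theorem IsColength.remaining_eq {T E : Set (Fin d → ℤ)} {c : Fin d → ℤ}
    {f : (Fin d → ℤ) → ℤ} (h : IsColength T E c f) (k : ℕ) :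
    remaining (T \ E) k = {α | α ∈ T \ E ∧ (k : ℤ) < f α} := by
  induction k with
  | zero =>
    ext α
    refine ⟨fun hα => ⟨hα, ?_⟩, fun hα => hα.1⟩
    have := h.pos hα.1 hα.2
    push_cast; omega
  | succ k ih =>
    ext α
    rw [remaining, ih, h.topLayer_eq]
    simp only [Set.mem_sdiff, Set.mem_ofPred_eq]
    push_cast
    constructor
    · rintro ⟨⟨h1, h2⟩, h3⟩
      exact ⟨h1, lt_of_le_of_ne h2 fun h4 => h3 ⟨h1, h4.symm⟩⟩
    · rintro ⟨h1, h2⟩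
      exact ⟨⟨h1, by omega⟩, fun h3 => by have := h3.2; omega⟩

/-- If `T \ E` has an element `o` of largest colength, the number of levels is the colength of
`o`, and the levels are the fibres of the colength function. -/
theorem IsColength.numLevels_eq {T E : Set (Fin d → ℤ)} {c : Fin d → ℤ}
    {f : (Fin d → ℤ) → ℤ} (h : IsColength T E c f) {o : Fin d → ℤ} (ho : o ∈ T \ E)
    (hmax : ∀ α ∈ T \ E, f α ≤ f o) : (numLevels (T \ E) : ℤ) = f o := by
  have h0 := h.nonneg o
  suffices numLevels (T \ E) = (f o).toNat by omega
  refine IsLeast.csInf_eq ⟨?_, fun k hk => ?_⟩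
  · rw [Set.mem_ofPred_eq, h.remaining_eq, Set.eq_empty_iff_forall_notMem]
    rintro α ⟨h1, h2⟩
    have := hmax α h1
    omega
  · rw [Set.mem_ofPred_eq, h.remaining_eq, Set.eq_empty_iff_forall_notMem] at hk
    have := hk o
    simp only [Set.mem_ofPred_eq, not_and, not_lt] at this
    have := this ho
    omega

theorem IsColength.mem_level {T E : Set (Fin d → ℤ)} {c : Fin d → ℤ}
    {f : (Fin d → ℤ) → ℤ} (h : IsColength T E c f) {i : ℕ} (hi : i ≤ numLevels (T \ E))
    {α : Fin d → ℤ} :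
    α ∈ level (T \ E) i ↔ α ∈ T \ E ∧ f α = numLevels (T \ E) - i + 1 := by
  rw [level, h.remaining_eq, h.topLayer_eq, Set.mem_ofPred_eq]
  push_cast [hi]
  rfl

/-! ### Level duality for a good set and its dual -/

theorem exists_mem_delta (γ α : Fin d → ℤ) (i : Fin d) :
    ∃ x ∈ delta Set.univ γ, x i = γ i ∧ ∀ j, j ≠ i → α j < x j ∧ γ j < x j := by
  have key : ∀ j, j ≠ i → α j < (if j = i then γ i else max (α j) (γ j) + 1) ∧
      γ j < (if j = i then γ i else max (α j) (γ j) + 1) := fun j hj => by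
    rw [if_neg hj]; omega
  exact ⟨fun j => if j = i then γ i else max (α j) (γ j) + 1,
    mem_delta.2 ⟨trivial, i, if_pos rfl, fun j hj => (key j hj).2⟩, if_pos rfl, key⟩

theorem gam_eq {E : Set (Fin d → ℤ)} {γ : Fin d → ℤ} (h1 : ∀ α, γ + 1 ≤ α → α ∈ E)
    (h2 : ∀ α ∈ delta Set.univ γ, α ∉ E) : gam E = γ := by
  suffices IsLeast {α | ∀ ν : Fin d → ℤ, 0 ≤ ν → α + ν ∈ E} (γ + 1) by
    rw [gam, conductor, leastVec_eq this, add_sub_cancel_right]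
  refine ⟨fun ν hν => h1 _ (le_add_of_nonneg_right hν), fun α hα i => ?_⟩
  by_contra hi
  change ¬ γ i + 1 ≤ α i at hi
  obtain ⟨x, hx, hxi, hxj⟩ := exists_mem_delta γ α i
  refine h2 x hx ?_
  have := hα (x - α) (sub_nonneg.2 fun j => ?_)
  · rwa [add_sub_cancel] at this
  · change α j ≤ x j
    by_cases hj : j = i
    · subst hj; omega
    · exact (hxj j hj).1.le

theorem notMem_delta_of_le {γ α : Fin d → ℤ} (h : γ + 1 ≤ α) : α ∉ delta Set.univ γ := by
  intro hmem
  obtain ⟨_, i, h1, _⟩ := mem_delta.1 hmem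
  have h2 : γ i + 1 ≤ α i := h i
  omega

theorem mem_dualSet_of_le {T : Set (Fin d → ℤ)} (hT0 : ∀ α ∈ T, 0 ≤ α) {γ α : Fin d → ℤ}
    (h : γ + 1 ≤ α) : α ∈ dualSet T γ :=
  mem_dualSet.2 fun β hβ => notMem_delta_of_le (h.trans (le_add_of_nonneg_right (hT0 β hβ)))

/-- If `E` is the dual of `T` with respect to `γ`, then `γ` is the vector `gam E`. -/
theorem gam_dualSet {T : Set (Fin d → ℤ)} (hT0 : ∀ α ∈ T, 0 ≤ α) (h0 : (0 : Fin d → ℤ) ∈ T)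
    (γ : Fin d → ℤ) : gam (dualSet T γ) = γ :=
  gam_eq (fun _ hα => mem_dualSet_of_le hT0 hα) fun α hα h =>
    mem_dualSet.1 h 0 h0 ((add_zero α).symm ▸ hα)

/-- The colength functions at `α` and at `γ + 1 - α` add up to a constant. -/
theorem IsColength.add_dual {T : Set (Fin d → ℤ)} (hT0 : ∀ α ∈ T, 0 ≤ α) {γ : Fin d → ℤ}
    {f : (Fin d → ℤ) → ℤ} (h : IsColength T (dualSet T γ) (γ + 1) f) (α : Fin d → ℤ) :
    f (γ + 1 - α) + f α = f 0 := by
  have hind : ∀ α i, faceInd (dualSet T γ) α i = 1 - faceInd T (γ + 1 - α - unitVec i) i := by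
    intro α i
    have := meetsFace_dualSet h.good hT0 γ α i
    by_cases h1 : MeetsFace T (γ + 1 - α - unitVec i) i
    · rw [faceInd_of h1, faceInd_of_not fun h2 => this.1 h2 h1]; rfl
    · rw [faceInd_of_not h1, faceInd_of (this.2 h1)]; rfl
  have key := eq_of_forall_add_unitVec_eq (g := fun α => f (γ + 1 - α) + f α) (by
    intro α i
    have h1 := h.step α i
    have h2 := h.step (γ + 1 - (α + unitVec i)) i
    rw [hind] at h1 h2
    have e1 : γ + 1 - (α + unitVec i) + unitVec i = γ + 1 - α := by ring
    have e2 : γ + 1 - (γ + 1 - (α + unitVec i)) - unitVec i = α := by ring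
    have e3 : γ + 1 - α - unitVec i = γ + 1 - (α + unitVec i) := by ring
    rw [e1, e2] at h2
    rw [e3] at h1
    linarith) α 0
  beta_reduce at key
  rw [key, sub_zero, h.zero _ le_rfl, zero_add]

/-- If the complement of `A` in a good set `T` is the dual of `T`, then the levels of `A` are
dual to each other. -/
theorem levelDuality_of_dualSet (hd : 1 ≤ d) {T A : Set (Fin d → ℤ)} (hT : IsGoodSet T)
    (hT0 : ∀ α ∈ T, 0 ≤ α) (hAT : A ⊆ T) {γ : Fin d → ℤ}
    (hE : T \ A = dualSet T γ) (h0 : (0 : Fin d → ℤ) ∈ A) : LevelDuality T A := by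
  have hA : A = T \ dualSet T γ := by
    rw [← hE, Set.sdiff_sdiff_cancel_left hAT]
  obtain ⟨f, hf⟩ := exists_isColength hd hT (isGoodSet_dualSet hT hT0 γ)
    (hE ▸ Set.sdiff_subset)
    fun _ hα => mem_dualSet_of_le hT0 hα
  have hN := hf.numLevels_eq (o := 0) (hA ▸ h0) fun α hα => hf.antitone (hT0 α hα.1)
  have hlev : ∀ {i}, i ≤ numLevels A → ∀ {α},
      (α ∈ level A i ↔ α ∈ A ∧ f α = numLevels A - i + 1) := by
    rw [hA]; exact fun hi => hf.mem_level hi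
  rw [← hA] at hN
  have hgam : gam (T \ A) = γ := by rw [hE]; exact gam_dualSet hT0 (hAT h0) γ
  have hsum := hf.add_dual hT0
  have hcomm : ∀ {α β : Fin d → ℤ}, α ∈ T → β ∈ delta T (γ - α) → α ∈ delta T (γ - β) := by
    intro α β hα h
    rw [mem_delta_sub] at h ⊢
    exact ⟨hα, add_comm α β ▸ h.2⟩
  -- a vector of `Δ(γ - β)` has colength at most `N - f β + 1` …
  have hupper : ∀ {β ω : Fin d → ℤ}, ω ∈ delta T (γ - β) → f ω ≤ numLevels A - f β + 1 := by
    intro β ω h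
    obtain ⟨hω, i, h1, h2⟩ := mem_delta.1 h
    have hle : γ + 1 - β - unitVec i ≤ ω := fun j => by
      by_cases hj : j = i
      · subst hj
        simp only [Pi.sub_apply, Pi.add_apply, Pi.one_apply, unitVec_self] at h1 ⊢
        omega
      · have := h2 j hj
        simp only [Pi.sub_apply, Pi.add_apply, Pi.one_apply, unitVec_ne hj] at this ⊢
        omega
    have h3 := hf.antitone hle
    have h4 := (hf.add_unitVec_le (γ + 1 - β - unitVec i) i).2
    rw [sub_add_cancel] at h4
    have h5 := hsum β
    omega
  -- … and some element of `A` attains this bound if `β` belongs to `A`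
  have hattain : ∀ {β : Fin d → ℤ}, β ∈ A →
      ∃ ω ∈ A, f ω = numLevels A - f β + 1 ∧ β ∈ delta T (γ - ω) := by
    intro β hβ
    have hβ' : β ∈ T \ dualSet T γ := hA ▸ hβ
    obtain ⟨i, hi⟩ := hf.exists_face β hβ'.2
    have hi' := (not_congr (meetsFace_dualSet hT hT0 γ β i)).1 hi
    rw [not_not] at hi'
    have hdual : ¬ MeetsFace (dualSet T γ) (γ + 1 - β - unitVec i) i := by
      rw [meetsFace_dualSet hT hT0, not_not]
      have : γ + 1 - (γ + 1 - β - unitVec i) - unitVec i = β := by ring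
      rw [this]
      exact meetsFace_of_mem hβ'.1 i
    obtain ⟨ω, hω, hfω⟩ := hf.exists_least (γ + 1 - β - unitVec i)
    have hωi : ω i = (γ + 1 - β - unitVec i) i := by
      obtain ⟨ε, hε, h1, h2⟩ := hi'
      exact le_antisymm ((hω.2 ⟨hε, h1⟩ i).trans h2.le) (hω.1.2 i)
    have hωA : ω ∈ A := by
      rw [hA]
      exact ⟨hω.1.1, fun h => hdual ⟨ω, h, hω.1.2, hωi⟩⟩
    refine ⟨ω, hωA, ?_, hcomm hβ'.1 (mem_delta.2 ⟨hω.1.1, i, ?_, fun j hj => ?_⟩)⟩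
    · have h1 := hf.add_unitVec_drop hi' hdual
      rw [sub_add_cancel] at h1
      have h2 := hsum β
      omega
    · rw [hωi]
      simp only [Pi.sub_apply, Pi.add_apply, Pi.one_apply, unitVec_self]
      ring
    · have := hω.1.2 j
      simp only [Pi.sub_apply, Pi.add_apply, Pi.one_apply, unitVec_ne hj] at this ⊢
      omega
  have hdU : ∀ {i}, i ≤ numLevels A → ∀ {β}, (β ∈ dualUnion T A i ↔
      ∃ ω ∈ A, f ω = numLevels A - i + 1 ∧ β ∈ delta T (γ - ω)) := by
    intro i hi β
    simp only [dualUnion, Set.mem_iUnion, hgam, hlev hi, exists_prop, and_assoc]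
  intro i hi1 hiN
  ext β
  rw [hlev (by omega), dualLevel, Set.mem_sdiff, hdU hiN]
  simp only [Set.mem_iUnion, not_exists]
  constructor
  · rintro ⟨⟨ω, hω, hfω, hβ⟩, hlow⟩
    have hβA : β ∈ A := by
      rw [hA]
      refine ⟨(mem_delta.1 hβ).1, fun h => ?_⟩
      exact mem_dualSet.1 h ω (hAT hω) (mem_delta_sub.1 (hcomm (hAT hω) hβ)).2
    refine ⟨hβA, ?_⟩
    have h1 := hupper (hcomm (hAT hω) hβ)
    have hβ' : β ∈ T \ dualSet T γ := hA ▸ hβA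
    have h2 := hf.pos hβ'.1 hβ'.2
    obtain ⟨ω', hω', h3, h4⟩ := hattain hβA
    by_contra hne
    refine hlow (f β).toNat ⟨by omega, by omega⟩ ((hdU (by omega)).2 ⟨ω', hω', ?_, h4⟩)
    omega
  · rintro ⟨hβA, hfβ⟩
    have hfβ' : f β = i := by omega
    obtain ⟨ω, hω, h3, h4⟩ := hattain hβA
    refine ⟨⟨ω, hω, by omega, h4⟩, fun j hj hβj => ?_⟩
    have hj' := Set.mem_Ico.1 hj
    obtain ⟨ω', hω', h5, h6⟩ := (hdU (by omega)).1 hβj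
    have := hupper (hcomm (hAT hω') h6)
    omega

/-! ### Finiteness of the number of levels -/

/-- Every set of nonnegative vectors that avoids an orthant `c + ℕ^d` has finitely many levels:
both domination and complete infima lower `∑ i, (c i - α i)⁺`. -/
theorem remaining_numLevels {A : Set (Fin d → ℤ)} (hA0 : ∀ α ∈ A, 0 ≤ α) {c : Fin d → ℤ}
    (hc : ∀ α ∈ A, ¬ c ≤ α) : remaining A (numLevels A) = ∅ := by
  suffices h : ∃ N, remaining A N = ∅ from Nat.sInf_mem (s := {N | remaining A N = ∅}) h
  have hsub : ∀ n, remaining A n ⊆ A := by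
    intro n
    induction n with
    | zero => exact subset_rfl
    | succ n ih => exact Set.sdiff_subset.trans ih
  have key : ∀ n, ∀ α ∈ remaining A n, n ≤ ∑ i, (c i - α i).toNat := by
    intro n
    induction n with
    | zero => simp
    | succ n ih =>
      rintro α ⟨hα, htop⟩
      refine lt_of_le_of_ne (ih α hα) fun heq => ?_
      have hlow : ∀ β ∈ remaining A n, α ≤ β → ∀ i, α i < β i → c i ≤ α i := by
        intro β hβ hle i hi
        by_contra! hci
        have := sum_toNat_lt hle hi hci
        have := ih β hβ
        omega
      obtain ⟨i, hi⟩ : ∃ i, α i < c i := by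
        by_contra! h
        exact hc α (hsub n hα) h
      refine htop ⟨⟨hα, fun β hβ hdom => ?_⟩, ?_⟩
      · exact hi.not_ge (hlow β hβ (fun j => (hdom j).le) i (hdom i))
      · rintro ⟨r, _, _, β, F, h1, _, h3⟩
        obtain ⟨k, hk⟩ := h3 i
        obtain ⟨_, _, hβ, h4, h5⟩ := h1 k
        refine hi.not_ge (hlow (β k) hβ.1 (fun j => ?_) i (h5 i hk))
        by_cases hj : j ∈ F k
        · exact (h4 j hj).ge
        · exact (h5 j hj).le
  refine ⟨∑ i, (c i).toNat + 1, Set.eq_empty_iff_forall_notMem.2 fun α hα => ?_⟩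
  have h1 := key _ α hα
  have h2 : ∑ i, (c i - α i).toNat ≤ ∑ i, (c i).toNat := Finset.sum_le_sum fun i _ => by
    have : 0 ≤ α i := hA0 α (hsub _ hα) i
    omega
  omega

theorem remaining_antitone (A : Set (Fin d → ℤ)) : Antitone (remaining A) :=
  antitone_nat_of_succ_le fun _ => Set.sdiff_subset

theorem level_subset (A : Set (Fin d → ℤ)) (i : ℕ) : level A i ⊆ A :=
  fun _ hα => remaining_antitone A (Nat.zero_le _) hα.1.1

theorem exists_mem_level {A : Set (Fin d → ℤ)} (h : remaining A (numLevels A) = ∅)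
    {α : Fin d → ℤ} (hα : α ∈ A) : ∃ i, 1 ≤ i ∧ i ≤ numLevels A ∧ α ∈ level A i := by
  classical
  have hex : ∃ k, α ∉ remaining A k := ⟨numLevels A, h ▸ Set.notMem_empty α⟩
  have hfind := Nat.find_spec hex
  have hle : Nat.find hex ≤ numLevels A := Nat.find_min' hex (h ▸ Set.notMem_empty α)
  obtain ⟨k, hk⟩ : ∃ k, Nat.find hex = k + 1 := Nat.exists_eq_succ_of_ne_zero fun h0 => by
    rw [h0] at hfind
    exact hfind hα
  have hmem : α ∈ remaining A k := not_not.1 (Nat.find_min hex (by omega))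
  rw [hk] at hfind hle
  refine ⟨numLevels A - k, by omega, by omega, ?_⟩
  rw [level, Nat.sub_sub_self (by omega)]
  by_contra htop
  exact hfind ⟨hmem, htop⟩

/-- Level duality makes every element of `A` dual to some element of `A`. -/
theorem LevelDuality.exists_dual {T A : Set (Fin d → ℤ)} (hdual : LevelDuality T A)
    (h : remaining A (numLevels A) = ∅) {α : Fin d → ℤ} (hα : α ∈ A) :
    ∃ ω ∈ A, α ∈ delta T (gam (T \ A) - ω) := by
  obtain ⟨i, h1, h2, hi⟩ := exists_mem_level h hα
  have hi' : α ∈ dualLevel T A (numLevels A - i + 1) := by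
    rw [hdual _ (by omega) (by omega)]
    have : numLevels A - (numLevels A - i + 1) + 1 = i := by omega
    rwa [this]
  obtain ⟨ω, hω, hmem⟩ := Set.mem_iUnion₂.1 hi'.1
  exact ⟨ω, level_subset A _ hω, hmem⟩

/-! ### Conductor, multiplicity and canonical ideal of a good semigroup -/

theorem mem_delta_iff {X : Set (Fin d → ℤ)} {α β : Fin d → ℤ} :
    β ∈ delta X α ↔ β ∈ X ∧ β ∈ delta Set.univ α := by
  simp [mem_delta]

theorem mem_delta_add_iff {γ α e : Fin d → ℤ} :
    α ∈ delta Set.univ (γ + e) ↔ α - e ∈ delta Set.univ γ := by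
  simp only [mem_delta, Set.mem_univ, true_and, Pi.add_apply, Pi.sub_apply]
  refine exists_congr fun i => and_congr ?_ (forall_congr' fun j =>
    imp_congr_right fun _ => ?_) <;> constructor <;> intro h <;> omega

namespace IsGoodSet

variable {X : Set (Fin d → ℤ)} (hX : IsGoodSet X) (hX0 : ∀ α ∈ X, 0 ≤ α) {c : Fin d → ℤ}
  (hc : ∀ ν : Fin d → ℤ, 0 ≤ ν → c + ν ∈ X)

include hX hX0 hc

theorem isLeast_conductor :
    IsLeast {α | ∀ ν : Fin d → ℤ, 0 ≤ ν → α + ν ∈ X} (conductor X) := by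
  let C : Set (Fin d → ℤ) := {α | ∀ ν : Fin d → ℤ, 0 ≤ ν → α + ν ∈ X}
  have hC0 : ∀ α ∈ C, 0 ≤ α := fun α hα => hX0 α (by simpa using hα 0 le_rfl)
  obtain ⟨μ, hμ⟩ := exists_isLeast_above (X := C) (by
    intro α hα β hβ ν hν
    have hsup : ∀ α ∈ C, ∀ x : Fin d → ℤ, x ⊔ α ∈ X := fun α hα x => by
      have := hα (x ⊔ α - α) (sub_nonneg.2 le_sup_right)
      rwa [add_sub_cancel] at this
    have h := hX.inf_mem _ (hsup α hα (α ⊓ β + ν)) _ (hsup β hβ (α ⊓ β + ν))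
    rwa [← sup_inf_left, sup_eq_left.2 (le_add_of_nonneg_right hν)] at h) 0 ⟨c, hc, hC0 c hc⟩
  have hμ' : IsLeast C μ := ⟨hμ.1.1, fun α hα => hμ.2 ⟨hα, hC0 α hα⟩⟩
  rw [conductor, leastVec_eq hμ']
  exact hμ'

theorem mem_of_gam_lt {α : Fin d → ℤ} (h : gam X + 1 ≤ α) : α ∈ X := by
  rw [gam, sub_add_cancel] at h
  have := (hX.isLeast_conductor hX0 hc).1 (α - conductor X) (sub_nonneg.2 h)
  rwa [add_sub_cancel] at this

/-- A good set has no elements in `Δ(γ)`: by (G2), one such element would produce all the others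
of the same face, and the conductor could be lowered. -/
theorem notMem_of_mem_delta_gam {α : Fin d → ℤ} (h : α ∈ delta Set.univ (gam X)) : α ∉ X := by
  intro hα
  obtain ⟨_, i, h1, h2⟩ := mem_delta.1 h
  have hmem : ∀ β, gam X + 1 ≤ β → β ∈ X := fun β => hX.mem_of_gam_lt hX0 hc
  let o : Fin d → ℤ := gam X + 1 - unitVec i
  have hoi : o i = gam X i := by simp [o]
  have hoj : ∀ j, j ≠ i → o j = gam X j + 1 := fun j hj => by simp [o, hj]
  have hstart : MeetsFace X o i := by
    refine ⟨α, hα, fun j => ?_, h1.trans hoi.symm⟩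
    by_cases hj : j = i
    · subst hj; rw [hoi, h1]
    · rw [hoj j hj]; exact h2 j hj
  have hface : ∀ x, o ≤ x → x i = gam X i → MeetsFace X x i := fun x hx hxi => by
    refine path_induction (P := fun δ => MeetsFace X δ i) hx hstart fun δ j h3 h4 h5 => ?_
    have hji : i ≠ j := by
      rintro rfl
      have h6 := (add_unitVec_le_iff.1 h4).2
      have h7 : o i ≤ δ i := h3 i
      omega
    refine h5.exchange hX hji (meetsFace_of_mem (hmem _ ?_) j)
    have : gam X + 1 = o + unitVec i := by simp [o]
    rw [this]
    exact add_le_add_left h3 _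
  have hlow : o ∈ {α | ∀ ν : Fin d → ℤ, 0 ≤ ν → α + ν ∈ X} := by
    intro ν hν
    have hle : o ≤ o + ν := le_add_of_nonneg_right hν
    by_cases hi : (o + ν) i = gam X i
    · obtain ⟨w, hw, h3, h4⟩ := hface _ hle hi
      have h5 := hX.inf_mem _ hw (o + ν + unitVec i) (hmem _ ?_)
      · convert h5 using 1
        funext j
        rw [Pi.inf_apply]
        have h6 : (o + ν) j ≤ w j := h3 j
        by_cases hj : j = i
        · subst hj
          rw [h4]
          exact (inf_eq_left.2 (le_add_unitVec _ _ j)).symm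
        · have : (o + ν + unitVec i) j = (o + ν) j := by simp [hj]
          rw [this]
          exact (inf_eq_right.2 h6).symm
      · have : gam X + 1 = o + unitVec i := by simp [o]
        rw [this]
        exact add_le_add_left hle _
    · refine hmem _ fun j => ?_
      have h3 : o j ≤ (o + ν) j := hle j
      change gam X j + 1 ≤ (o + ν) j
      by_cases hj : j = i
      · subst hj; omega
      · rw [← hoj j hj]; exact h3
  have h3 : conductor X i ≤ o i := (hX.isLeast_conductor hX0 hc).2 hlow i
  rw [hoi, gam, Pi.sub_apply, Pi.one_apply] at h3
  omega

end IsGoodSet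

/-- The elements of colength one, in the situation where `T` contains the orthant at `γ` and `E`
does not meet `Δ(γ)`. -/
theorem IsColength.mem_delta_of_eq_one {T E : Set (Fin d → ℤ)} {γ : Fin d → ℤ}
    {f : (Fin d → ℤ) → ℤ} (h : IsColength T E (γ + 1) f) (hT : ∀ α, γ ≤ α → α ∈ T)
    (hE : ∀ α ∈ delta Set.univ γ, α ∉ E) {α : Fin d → ℤ} (hα : α ∈ T \ E) (hf : f α = 1) :
    α ∈ delta Set.univ γ := by
  obtain ⟨i, hi⟩ := h.exists_face α hα.2
  have key : ∀ k, α k ≤ γ k → α k = γ k ∧ k = i := by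
    intro k hk
    by_contra hne
    obtain ⟨x, hx, hxk, hxj⟩ := exists_mem_delta γ α k
    have hle : α ≤ x := fun j => by
      by_cases hj : j = k
      · subst hj; exact hk.trans hxk.ge
      · exact (hxj j hj).1.le
    have hlt : α i < x i := by
      by_cases hik : i = k
      · subst hik; rw [hxk]; exact lt_of_le_of_ne hk fun h => hne ⟨h, rfl⟩
      · exact (hxj i hik).1
    have h1 := h.lt_of_missed hα.1 hi hle hlt
    have h2 := h.pos (hT x (le_of_mem_delta hx)) (hE x hx)
    omega
  have hex : ∃ k, α k ≤ γ k := by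
    by_contra! hall
    exact hα.2 (h.conductor α hall)
  obtain ⟨k, hk⟩ := hex
  refine mem_delta.2 ⟨trivial, k, (key k hk).1, fun j hj => ?_⟩
  by_contra! hle
  exact hj ((key j hle).2.trans (key k hk).2.symm)

theorem nonneg_of_mem_dualSet {X : Set (Fin d → ℤ)} {γ : Fin d → ℤ}
    (hX : ∀ α, γ + 1 ≤ α → α ∈ X) {α : Fin d → ℤ} (hα : α ∈ dualSet X γ) : 0 ≤ α := by
  intro i
  by_contra hi
  change ¬ 0 ≤ α i at hi
  obtain ⟨x, hx, hxi, hxj⟩ := exists_mem_delta γ (γ + α) i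
  refine mem_dualSet.1 hα (x - α) (hX _ fun j => ?_) (by rwa [add_sub_cancel])
  change γ j + 1 ≤ x j - α j
  by_cases hj : j = i
  · subst hj; omega
  · have : γ j + α j < x j := (hxj j hj).1
    omega

section Semigroup

variable {S : AddSubmonoid (Fin d → ℤ)}

theorem IsGood.isGoodSet (hS : IsGood S) : IsGoodSet (S : Set (Fin d → ℤ)) :=
  ⟨hS.inf_mem, hS.exists_gt⟩

theorem IsGood.mem_of_gam_lt (hS : IsGood S) {α : Fin d → ℤ}
    (h : gam (S : Set (Fin d → ℤ)) + 1 ≤ α) : α ∈ S := by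
  obtain ⟨c, _, hc⟩ := hS.exists_conductor
  exact hS.isGoodSet.mem_of_gam_lt hS.nonneg hc h

theorem IsGood.gam_add_one_nonneg (hS : IsGood S) : 0 ≤ gam (S : Set (Fin d → ℤ)) + 1 :=
  hS.nonneg _ (hS.mem_of_gam_lt le_rfl)

theorem IsGood.notMem_of_mem_delta_gam (hS : IsGood S) {α : Fin d → ℤ}
    (h : α ∈ delta Set.univ (gam (S : Set (Fin d → ℤ)))) : α ∉ S := by
  obtain ⟨c, _, hc⟩ := hS.exists_conductor
  exact hS.isGoodSet.notMem_of_mem_delta_gam hS.nonneg hc h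

theorem IsGood.isLeast_mult (hS : IsGood S) :
    IsLeast {α | α ∈ S ∧ ∀ i, 0 < α i} (mult S) := by
  obtain ⟨c, hcS, hc⟩ := hS.exists_conductor
  obtain ⟨μ, hμ⟩ := exists_isLeast_above (X := {α | α ∈ S ∧ ∀ i, 0 < α i}) (by
    rintro α ⟨hα, h1⟩ β ⟨hβ, h2⟩
    exact ⟨hS.inf_mem α hα β hβ, fun i => lt_min (h1 i) (h2 i)⟩) 0
    ⟨c + 1, ⟨hc 1 zero_le_one, fun i => by
      have : 0 ≤ c i := hS.nonneg c hcS i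
      simp only [Pi.add_apply, Pi.one_apply]; omega⟩,
      add_nonneg (hS.nonneg c hcS) zero_le_one⟩
  have hμ' : IsLeast {α | α ∈ S ∧ ∀ i, 0 < α i} μ :=
    ⟨hμ.1.1, fun α hα => hμ.2 ⟨hα, hS.nonneg α hα.1⟩⟩
  rw [mult, leastVec_eq hμ']
  exact hμ'

theorem IsGood.mult_mem (hS : IsGood S) : mult S ∈ S := hS.isLeast_mult.1.1

theorem IsGood.mult_pos (hS : IsGood S) (i : Fin d) : 0 < mult S i := hS.isLeast_mult.1.2 i

theorem IsGood.one_le_mult (hS : IsGood S) : 1 ≤ mult S := fun i => hS.mult_pos i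

theorem IsGood.mult_ne_zero (hd : 1 ≤ d) (hS : IsGood S) : mult S ≠ 0 := fun h => by
  have := hS.mult_pos ⟨0, hd⟩
  rw [h] at this
  exact lt_irrefl _ this

theorem mem_Ap {α : Fin d → ℤ} : α ∈ Ap S ↔ α ∈ S ∧ α - mult S ∉ S := by
  refine and_congr_right fun _ => not_congr ⟨?_, fun h => ⟨_, h, by simp⟩⟩
  rintro ⟨β, hβ, rfl⟩
  simpa using hβ

theorem zero_mem_Ap (hd : 1 ≤ d) (hS : IsGood S) : (0 : Fin d → ℤ) ∈ Ap S :=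
  mem_Ap.2 ⟨S.zero_mem, fun h => by
    have h1 := hS.nonneg _ h ⟨0, hd⟩
    have h2 := hS.mult_pos ⟨0, hd⟩
    simp only [Pi.zero_apply, Pi.sub_apply] at h1
    omega⟩

theorem mem_sdiff_Ap (hS : IsGood S) {α : Fin d → ℤ} :
    α ∈ (S : Set (Fin d → ℤ)) \ Ap S ↔ α - mult S ∈ S := by
  rw [Set.mem_sdiff, mem_Ap]
  constructor
  · rintro ⟨h1, h2⟩
    by_contra h
    exact h2 ⟨h1, h⟩
  · intro h
    refine ⟨?_, fun h' => h'.2 h⟩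
    simpa using S.add_mem h hS.mult_mem

theorem IsGood.isGoodSet_sdiff_Ap (hS : IsGood S) :
    IsGoodSet ((S : Set (Fin d → ℤ)) \ Ap S) := by
  constructor
  · intro α hα β hβ
    rw [mem_sdiff_Ap hS] at hα hβ ⊢
    convert hS.inf_mem _ hα _ hβ using 1
    funext i
    simp only [Pi.sub_apply, Pi.inf_apply]
    omega
  · intro α hα β hβ hne i hi
    rw [mem_sdiff_Ap hS] at hα hβ
    obtain ⟨ε, hε, h1, h2⟩ := hS.exists_gt _ hα _ hβ (fun h => hne (sub_left_injective h)) i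
      (by simp only [Pi.sub_apply, hi])
    refine ⟨ε + mult S, (mem_sdiff_Ap hS).2 (by simpa using hε), ?_, fun j hj => ?_⟩
    · simp only [Pi.sub_apply] at h1
      rw [Pi.add_apply]; omega
    · have := h2 j hj
      simp only [Pi.sub_apply] at this
      rw [Pi.add_apply]
      exact ⟨by omega, fun h => by have := this.2 (by omega); omega⟩

theorem mem_dualSet_add_iff {α : Fin d → ℤ} {X : Set (Fin d → ℤ)} {γ e : Fin d → ℤ} :
    α ∈ dualSet X (γ + e) ↔ α - e ∈ dualSet X γ := by
  rw [dualSet, dualSet, Set.mem_ofPred_eq, Set.mem_ofPred_eq]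
  have : γ + e - α = γ - (α - e) := by ring
  rw [this]

/-- The canonical ideal of `S` is stable under addition of elements of `S`. -/
theorem add_mem_dualSet {γ α β : Fin d → ℤ} (hα : α ∈ dualSet (S : Set (Fin d → ℤ)) γ)
    (hβ : β ∈ S) : α + β ∈ dualSet (S : Set (Fin d → ℤ)) γ :=
  mem_dualSet.2 fun ε hε => add_assoc α β ε ▸ mem_dualSet.1 hα _ (S.add_mem hβ hε)

theorem IsGood.subset_dualSet (hS : IsGood S) {α : Fin d → ℤ} (hα : α ∈ S) :
    α ∈ dualSet (S : Set (Fin d → ℤ)) (gam (S : Set (Fin d → ℤ))) :=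
  mem_dualSet.2 fun _ hβ h => hS.notMem_of_mem_delta_gam h (S.add_mem hα hβ)

theorem gam_sdiff_Ap (hS : IsGood S) :
    gam ((S : Set (Fin d → ℤ)) \ Ap S) = gam (S : Set (Fin d → ℤ)) + mult S := by
  refine gam_eq (fun α hα => (mem_sdiff_Ap hS).2 (hS.mem_of_gam_lt ?_)) fun α hα h => ?_
  · rw [add_right_comm] at hα
    exact le_sub_iff_add_le.2 hα
  · exact hS.notMem_of_mem_delta_gam (mem_delta_add_iff.1 hα) ((mem_sdiff_Ap hS).1 h)

theorem remaining_Ap (hS : IsGood S) : remaining (Ap S) (numLevels (Ap S)) = ∅ := by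
  refine remaining_numLevels (c := gam (S : Set (Fin d → ℤ)) + 1 + mult S)
    (fun α hα => hS.nonneg α (mem_Ap.1 hα).1) fun α hα hle => ?_
  exact (mem_Ap.1 hα).2 (hS.mem_of_gam_lt (le_sub_iff_add_le.2 hle))

/-- A nonnegative vector outside `S` enters `S` at some point when the multiplicity is added
repeatedly. -/
theorem IsGood.exists_nsmul_mult (hS : IsGood S) {α : Fin d → ℤ} (hα : α ∉ S) :
    ∃ n : ℕ, α + n • mult S ∉ S ∧ α + n • mult S + mult S ∈ S := by
  classical
  have hex : ∃ n : ℕ, α + n • mult S ∈ S := by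
    let N : ℕ := ∑ i, (gam (S : Set (Fin d → ℤ)) i + 1 - α i).toNat
    refine ⟨N, hS.mem_of_gam_lt fun i => ?_⟩
    have h1 : (gam (S : Set (Fin d → ℤ)) i + 1 - α i).toNat ≤ N :=
      Finset.single_le_sum (f := fun i => (gam (S : Set (Fin d → ℤ)) i + 1 - α i).toNat)
        (fun _ _ => Nat.zero_le _) (Finset.mem_univ i)
    have h2 : (N : ℤ) ≤ N * mult S i :=
      le_mul_of_one_le_right (Int.natCast_nonneg N) (hS.mult_pos i)
    change gam (S : Set (Fin d → ℤ)) i + 1 ≤ α i + (N • mult S) i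
    rw [Pi.smul_apply, nsmul_eq_mul]
    omega
  obtain ⟨n, hn⟩ : ∃ n, Nat.find hex = n + 1 := Nat.exists_eq_succ_of_ne_zero fun h0 => by
    have := Nat.find_spec hex
    rw [h0, zero_nsmul, add_zero] at this
    exact hα this
  refine ⟨n, Nat.find_min hex (by omega), ?_⟩
  have := Nat.find_spec hex
  rwa [hn, succ_nsmul, ← add_assoc] at this

/-! ### Symmetric semigroups -/

theorem isSymmetric_iff_levelDuality (hd : 1 ≤ d) (hS : IsGood S) :
    IsSymmetric S ↔ LevelDuality (S : Set (Fin d → ℤ)) (Ap S) := by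
  constructor
  · intro h
    refine levelDuality_of_dualSet hd hS.isGoodSet hS.nonneg (fun α hα => (mem_Ap.1 hα).1)
      (γ := gam (S : Set (Fin d → ℤ)) + mult S) ?_ (zero_mem_Ap hd hS)
    ext α
    rw [mem_sdiff_Ap hS, mem_dualSet_add_iff]
    exact h _
  · intro h α
    refine ⟨fun hα => hS.subset_dualSet hα, fun hα => ?_⟩
    by_contra hαS
    obtain ⟨n, h1, h2⟩ := hS.exists_nsmul_mult hαS
    obtain ⟨ω, hω, hmem⟩ := h.exists_dual (remaining_Ap hS)
      (mem_Ap.2 ⟨h2, by rwa [add_sub_cancel_right]⟩)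
    rw [gam_sdiff_Ap hS, mem_delta_sub, add_comm ω] at hmem
    have hK := add_mem_dualSet hα (S.nsmul_mem hS.mult_mem n)
    rw [← add_sub_cancel_right (α + n • mult S) (mult S), ← mem_dualSet_add_iff] at hK
    exact mem_dualSet.1 hK ω (mem_Ap.1 hω).1 hmem.2

end Semigroup

section AlmostSymmetric

variable {S : AddSubmonoid (Fin d → ℤ)}

/-! ### Top and bottom level of the Apéry set -/

/-- `S` is local: `0` is its only element with a zero component. -/
def IsLocal (S : AddSubmonoid (Fin d → ℤ)) : Prop := ∀ β ∈ S, ∀ i, β i = 0 → β = 0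

theorem IsLocal.pos (hS : IsGood S) (hloc : IsLocal S) {β : Fin d → ℤ} (hβ : β ∈ S)
    (h0 : β ≠ 0) (i : Fin d) : 0 < β i :=
  lt_of_le_of_ne (hS.nonneg β hβ i) fun h => h0 (hloc β hβ i h.symm)

theorem topLayer_Ap_subset (hd : 1 ≤ d) (hS : IsGood S) :
    topLayer (Ap S) ⊆ delta Set.univ (gam (S : Set (Fin d → ℤ)) + mult S) := by
  obtain ⟨f, hf⟩ := exists_isColength hd hS.isGoodSet hS.isGoodSet_sdiff_Ap Set.sdiff_subset
    (c := gam (S : Set (Fin d → ℤ)) + mult S + 1) fun α hα => (mem_sdiff_Ap hS).2 <|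
      hS.mem_of_gam_lt <| le_sub_iff_add_le.2 <| by rwa [add_right_comm]
  have hAp : Ap S = (S : Set (Fin d → ℤ)) \ ((S : Set (Fin d → ℤ)) \ Ap S) :=
    (Set.sdiff_sdiff_cancel_left fun α hα => (mem_Ap.1 hα).1).symm
  have h0 := hf.remaining_eq 0
  have h1 := hf.topLayer_eq 0
  rw [← h0, ← hAp] at h1
  rw [remaining] at h1
  rw [h1]
  rintro α ⟨hα, hfα⟩
  refine hf.mem_delta_of_eq_one (fun α hα => hS.mem_of_gam_lt ?_) (fun α hα h => ?_)
    (hAp ▸ hα) (by simpa using hfα)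
  · exact (add_le_add_right hS.one_le_mult _).trans hα
  · exact hS.notMem_of_mem_delta_gam (mem_delta_add_iff.1 hα) ((mem_sdiff_Ap hS).1 h)

/-- The bottom level of the Apéry set of a local semigroup is `{0}`. -/
theorem eq_zero_of_mem_level_one (hd : 1 ≤ d) (hS : IsGood S) (hloc : IsLocal S)
    {α : Fin d → ℤ} (hα : α ∈ level (Ap S) 1) : α = 0 := by
  by_contra hne
  obtain ⟨i, hi1, hi2, h0⟩ := exists_mem_level (remaining_Ap hS) (zero_mem_Ap hd hS)
  have hrem : α ∈ remaining (Ap S) (numLevels (Ap S) - i) :=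
    remaining_antitone (Ap S) (by omega) hα.1.1
  exact h0.1.2 α hrem fun j => hloc.pos hS (mem_Ap.1 (level_subset _ _ hα)).1 hne j

theorem notMem_PF_of_not_nonneg {α : Fin d → ℤ} (h : ¬ 0 ≤ α) : α ∉ PF S := fun hα => h hα.1

theorem mem_setW (hd : 1 ≤ d) (hS : IsGood S) (hloc : IsLocal S) {α : Fin d → ℤ} :
    α ∈ setW S ↔ α ∈ delta Set.univ (gam (S : Set (Fin d → ℤ)) + mult S) ∨
      (α ∈ Ap S ∧ α - mult S ∉ PF S) := by
  constructor
  · rintro ((h | h) | ⟨⟨i, _, _, h⟩, h'⟩)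
    · rw [Set.mem_singleton_iff] at h
      subst h
      refine Or.inr ⟨zero_mem_Ap hd hS, notMem_PF_of_not_nonneg fun h => ?_⟩
      have h1 : 0 ≤ 0 - mult S ⟨0, hd⟩ := h ⟨0, hd⟩
      have h2 := hS.mult_pos ⟨0, hd⟩
      omega
    · exact Or.inl (mem_delta_iff.1 h).2
    · exact Or.inr ⟨level_subset _ _ h, h'⟩
  · intro h
    by_cases hdelta : α ∈ delta Set.univ (gam (S : Set (Fin d → ℤ)) + mult S)
    · refine Or.inl (Or.inr (mem_delta_iff.2 ⟨?_, hdelta⟩))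
      exact (hS.gam_add_one_nonneg.trans (add_le_add_right hS.one_le_mult _)).trans
        (le_of_mem_delta hdelta)
    · obtain ⟨hα, hPF⟩ := h.resolve_left hdelta
      obtain ⟨i, h1, h2, hi⟩ := exists_mem_level (remaining_Ap hS) hα
      by_cases hi1 : i = 1
      · subst hi1
        exact Or.inl (Or.inl (eq_zero_of_mem_level_one hd hS hloc hi))
      by_cases hiN : i = numLevels (Ap S)
      · rw [hiN, level, Nat.sub_self] at hi
        exact absurd (topLayer_Ap_subset hd hS hi) hdelta
      · exact Or.inr ⟨⟨i, by omega, by omega, hi⟩, hPF⟩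

theorem setW_subset (hd : 1 ≤ d) (hS : IsGood S) (hloc : IsLocal S) :
    setW S ⊆ (S : Set (Fin d → ℤ)) := fun α hα => by
  rcases (mem_setW hd hS hloc).1 hα with h | h
  · exact hS.mem_of_gam_lt ((add_le_add_right hS.one_le_mult _).trans (le_of_mem_delta h))
  · exact (mem_Ap.1 h.1).1

theorem zero_mem_setW : (0 : Fin d → ℤ) ∈ setW S := Or.inl (Or.inl rfl)

theorem notMem_setW_of_le (hd : 1 ≤ d) (hS : IsGood S) (hloc : IsLocal S) {α : Fin d → ℤ}
    (hα : gam (S : Set (Fin d → ℤ)) + mult S + 1 ≤ α) : α ∉ setW S := fun h => by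
  rcases (mem_setW hd hS hloc).1 h with h | h
  · exact notMem_delta_of_le hα h
  · rw [add_right_comm] at hα
    exact (mem_Ap.1 h.1).2 (hS.mem_of_gam_lt (le_sub_iff_add_le.2 hα))

theorem gam_sdiff_setW (hd : 1 ≤ d) (hS : IsGood S) (hloc : IsLocal S) :
    gam ((S : Set (Fin d → ℤ)) \ setW S) = gam (S : Set (Fin d → ℤ)) + mult S := by
  refine gam_eq (fun α hα => ⟨hS.mem_of_gam_lt ?_, notMem_setW_of_le hd hS hloc hα⟩)
    fun α hα h => h.2 ((mem_setW hd hS hloc).2 (Or.inl hα))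
  refine le_trans ?_ hα
  rw [add_right_comm]
  exact le_add_of_nonneg_right (zero_le_one.trans hS.one_le_mult)

theorem remaining_setW (hd : 1 ≤ d) (hS : IsGood S) (hloc : IsLocal S) :
    remaining (setW S) (numLevels (setW S)) = ∅ :=
  remaining_numLevels (fun α hα => hS.nonneg α (setW_subset hd hS hloc hα))
    fun _ hα hle => notMem_setW_of_le hd hS hloc hle hα

/-! ### Pseudo-Frobenius elements -/

theorem add_mem_of_mem_union_PF {α β : Fin d → ℤ} (hα : α ∈ (S : Set (Fin d → ℤ)) ∪ PF S)
    (hβ : β ∈ S) (h0 : β ≠ 0) : α + β ∈ S := by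
  rcases hα with h | h
  · exact S.add_mem h hβ
  · exact h.2.2 β hβ h0

theorem nonneg_of_mem_union_PF (hS : IsGood S) {α : Fin d → ℤ}
    (hα : α ∈ (S : Set (Fin d → ℤ)) ∪ PF S) : 0 ≤ α := by
  rcases hα with h | h
  · exact hS.nonneg α h
  · exact h.1

theorem union_PF_sdiff_setZ :
    ((S : Set (Fin d → ℤ)) ∪ PF S) \ setZ S = (S : Set (Fin d → ℤ)) \ {0} := by
  ext α
  simp only [setZ, Set.mem_sdiff, Set.mem_union, SetLike.mem_coe, Set.mem_singleton_iff]
  constructor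
  · rintro ⟨h1 | h1, h2⟩
    · exact ⟨h1, fun h => h2 (Or.inr h)⟩
    · exact absurd (Or.inl h1) h2
  · rintro ⟨h1, h2⟩
    refine ⟨Or.inl h1, ?_⟩
    rintro (h | h)
    · exact h.2.1 h1
    · exact h2 h

theorem setZ_subset : setZ S ⊆ (S : Set (Fin d → ℤ)) ∪ PF S := by
  rintro α (h | h)
  · exact Or.inr h
  · exact Or.inl (Set.mem_singleton_iff.1 h ▸ S.zero_mem)

theorem zero_mem_setZ : (0 : Fin d → ℤ) ∈ setZ S := Or.inr rfl

/-- For `S ≠ ℕ^d` the conductor of `S` is nonzero. -/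
theorem exists_gam_nonneg (hS : IsGood S) (hne : (S : Set (Fin d → ℤ)) ≠ natVec d) :
    ∃ i, 0 ≤ gam (S : Set (Fin d → ℤ)) i := by
  by_contra! h
  refine hne (Set.Subset.antisymm hS.nonneg fun α hα => hS.mem_of_gam_lt fun i => ?_)
  have h1 := h i
  have h2 : 0 ≤ α i := hα i
  change gam (S : Set (Fin d → ℤ)) i + 1 ≤ α i
  omega

theorem not_le_zero (hS : IsGood S) (hne : (S : Set (Fin d → ℤ)) ≠ natVec d) :
    ¬ gam (S : Set (Fin d → ℤ)) + 1 ≤ 0 := fun h => by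
  obtain ⟨i, hi⟩ := exists_gam_nonneg hS hne
  have : gam (S : Set (Fin d → ℤ)) i + 1 ≤ 0 := h i
  omega

theorem exists_nonneg_mem_delta_gam (hS : IsGood S) (hne : (S : Set (Fin d → ℤ)) ≠ natVec d) :
    ∃ α, 0 ≤ α ∧ α ∈ delta Set.univ (gam (S : Set (Fin d → ℤ))) := by
  obtain ⟨i, hi⟩ := exists_gam_nonneg hS hne
  obtain ⟨x, hx, hxi, hxj⟩ := exists_mem_delta (gam (S : Set (Fin d → ℤ))) 0 i
  refine ⟨x, fun j => ?_, hx⟩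
  change 0 ≤ x j
  by_cases hj : j = i
  · subst hj; omega
  · exact (hxj j hj).1.le

theorem gam_sdiff_zero (hS : IsGood S) (hne : (S : Set (Fin d → ℤ)) ≠ natVec d) :
    gam ((S : Set (Fin d → ℤ)) \ {0}) = gam (S : Set (Fin d → ℤ)) := by
  refine gam_eq (fun α hα => ⟨hS.mem_of_gam_lt hα, ?_⟩) fun α hα h =>
    hS.notMem_of_mem_delta_gam hα h.1
  rintro rfl
  exact not_le_zero hS hne hα

theorem remaining_setZ (hS : IsGood S) (hne : (S : Set (Fin d → ℤ)) ≠ natVec d) :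
    remaining (setZ S) (numLevels (setZ S)) = ∅ := by
  refine remaining_numLevels (c := gam (S : Set (Fin d → ℤ)) + 1)
    (fun α hα => nonneg_of_mem_union_PF hS (setZ_subset hα)) ?_
  rintro α (hα | rfl) hle
  · exact hα.2.1 (hS.mem_of_gam_lt hle)
  · exact not_le_zero hS hne hle

/-- Under level duality of `setZ S`, each of its elements is dual to another one. -/
theorem exists_dual_setZ (hS : IsGood S) (hne : (S : Set (Fin d → ℤ)) ≠ natVec d)
    (hZ : LevelDuality ((S : Set (Fin d → ℤ)) ∪ PF S) (setZ S)) {α : Fin d → ℤ}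
    (hα : α ∈ setZ S) :
    ∃ ω ∈ setZ S, ω + α ∈ delta Set.univ (gam (S : Set (Fin d → ℤ))) := by
  obtain ⟨ω, hω, hmem⟩ := hZ.exists_dual (remaining_setZ hS hne) hα
  rw [union_PF_sdiff_setZ, gam_sdiff_zero hS hne, mem_delta_sub] at hmem
  exact ⟨ω, hω, hmem.2⟩

/-! ### Semigroups that are not local -/

/-- If `β ∈ S` has a zero component, (G2) yields an element of `S` supported on the zero set of
`β`; pseudo-Frobenius elements would then be infima of elements of `S`. -/
theorem PF_eq_empty (hS : IsGood S) (hloc : ¬ IsLocal S) : PF S = ∅ := by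
  unfold IsLocal at hloc
  push Not at hloc
  obtain ⟨β, hβ, i, hi, h0⟩ := hloc
  obtain ⟨ε, hε, h1, h2⟩ := hS.exists_gt 0 S.zero_mem β hβ (Ne.symm h0) i hi.symm
  refine Set.eq_empty_iff_forall_notMem.2 fun α hα => hα.2.1 ?_
  have hε0 : ε ≠ 0 := by rintro rfl; exact lt_irrefl _ h1
  convert hS.inf_mem _ (hα.2.2 β hβ h0) _ (hα.2.2 ε hε hε0) using 1
  funext j
  rw [Pi.inf_apply, Pi.add_apply, Pi.add_apply]
  have h3 : 0 ≤ β j := hS.nonneg β hβ j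
  have h4 : 0 ≤ ε j := hS.nonneg ε hε j
  by_cases hj : j = i
  · subst hj; rw [hi]; omega
  · have := (h2 j hj).2
    rw [Pi.zero_apply] at this
    by_cases hβj : β j = 0
    · rw [hβj]; omega
    · have := this (Ne.symm hβj)
      omega

theorem not_isAlmostSymmetric (hS : IsGood S) (hloc : ¬ IsLocal S)
    (hne : (S : Set (Fin d → ℤ)) ≠ natVec d) : ¬ IsAlmostSymmetric S := by
  intro h
  obtain ⟨α, h0, hα⟩ := exists_nonneg_mem_delta_gam hS hne
  have : α ∈ PF S := by
    rw [h]
    exact Or.inl (mem_delta_iff.2 ⟨h0, hα⟩)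
  rw [PF_eq_empty hS hloc] at this
  exact this

theorem not_levelDuality_setZ (hS : IsGood S) (hloc : ¬ IsLocal S)
    (hne : (S : Set (Fin d → ℤ)) ≠ natVec d) :
    ¬ LevelDuality ((S : Set (Fin d → ℤ)) ∪ PF S) (setZ S) := by
  intro h
  obtain ⟨ω, hω, hmem⟩ := exists_dual_setZ hS hne h zero_mem_setZ
  rw [setZ, PF_eq_empty hS hloc, Set.empty_union, Set.mem_singleton_iff] at hω
  subst hω
  rw [add_zero] at hmem
  exact hS.notMem_of_mem_delta_gam hmem S.zero_mem

/-! ### Local semigroups -/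

theorem IsGood.isGoodSet_sdiff_zero (hd : 1 ≤ d) (hS : IsGood S) (hloc : IsLocal S) :
    IsGoodSet ((S : Set (Fin d → ℤ)) \ {0}) := by
  constructor
  · rintro α ⟨hα, hα0⟩ β ⟨hβ, hβ0⟩
    refine ⟨hS.inf_mem α hα β hβ, fun h => ?_⟩
    have h1 := hloc.pos hS hα hα0 ⟨0, hd⟩
    have h2 := hloc.pos hS hβ hβ0 ⟨0, hd⟩
    have h3 : min (α ⟨0, hd⟩) (β ⟨0, hd⟩) = 0 := congrFun (Set.mem_singleton_iff.1 h) ⟨0, hd⟩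
    omega
  · rintro α ⟨hα, hα0⟩ β ⟨hβ, hβ0⟩ hne i hi
    obtain ⟨ε, hε, h1, h2⟩ := hS.exists_gt α hα β hβ hne i hi
    refine ⟨ε, ⟨hε, ?_⟩, h1, h2⟩
    rintro rfl
    have := hloc.pos hS hα hα0 i
    rw [Pi.zero_apply] at h1
    omega

theorem mem_dualSet_sdiff_zero (hS : IsGood S) (hloc : IsLocal S) {γ α : Fin d → ℤ} :
    α ∈ dualSet ((S : Set (Fin d → ℤ)) \ {0}) γ ↔
      α ∈ dualSet (S : Set (Fin d → ℤ)) γ ∨ α ∈ delta Set.univ γ := by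
  constructor
  · intro h
    refine or_iff_not_imp_right.2 fun hα => mem_dualSet.2 fun β hβ hmem => ?_
    refine mem_dualSet.1 h β ⟨hβ, ?_⟩ hmem
    rintro rfl
    exact hα (by rwa [add_zero] at hmem)
  · rintro (h | h) <;> refine mem_dualSet.2 fun β hβ hmem => ?_
    · exact mem_dualSet.1 h β hβ.1 hmem
    · obtain ⟨_, k, hk, _⟩ := mem_delta.1 hmem
      have h1 : γ k ≤ α k := le_of_mem_delta h k
      have h2 := hloc.pos hS hβ.1 hβ.2 k
      rw [Pi.add_apply] at hk
      omega

/-- One inclusion of the equality defining almost symmetry always holds. -/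
theorem PF_subset (hS : IsGood S) {α : Fin d → ℤ} (hα : α ∈ PF S) :
    α ∈ delta Set.univ (gam (S : Set (Fin d → ℤ))) ∨
      α ∈ dualSet (S : Set (Fin d → ℤ)) (gam (S : Set (Fin d → ℤ))) := by
  refine or_iff_not_imp_left.2 fun hd => mem_dualSet.2 fun β hβ hmem => ?_
  have h0 : β ≠ 0 := by
    rintro rfl
    exact hd (by rwa [add_zero] at hmem)
  exact hS.notMem_of_mem_delta_gam hmem (hα.2.2 β hβ h0)

theorem delta_subset_PF (hS : IsGood S) (hloc : IsLocal S) {α : Fin d → ℤ} (h0 : 0 ≤ α)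
    (hα : α ∈ delta Set.univ (gam (S : Set (Fin d → ℤ)))) : α ∈ PF S := by
  refine ⟨h0, hS.notMem_of_mem_delta_gam hα, fun β hβ hβ0 => hS.mem_of_gam_lt fun i => ?_⟩
  have h1 : gam (S : Set (Fin d → ℤ)) i ≤ α i := le_of_mem_delta hα i
  have h2 := hloc.pos hS hβ hβ0 i
  change gam (S : Set (Fin d → ℤ)) i + 1 ≤ α i + β i
  omega

/-- A local semigroup is almost symmetric if and only if its canonical ideal lies in
`S ∪ PF(S)`. -/
theorem isAlmostSymmetric_iff (hS : IsGood S) (hloc : IsLocal S) :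
    IsAlmostSymmetric S ↔ dualSet (S : Set (Fin d → ℤ)) (gam (S : Set (Fin d → ℤ))) ⊆
      (S : Set (Fin d → ℤ)) ∪ PF S := by
  constructor
  · intro h α hα
    by_cases hαS : α ∈ S
    · exact Or.inl hαS
    · refine Or.inr ?_
      rw [h]
      exact Or.inr ⟨nonneg_of_mem_dualSet (fun _ => hS.mem_of_gam_lt) hα, hαS, hα⟩
  · intro h
    refine Set.Subset.antisymm (fun α hα => ?_) ?_
    · exact (PF_subset hS hα).imp (fun h => mem_delta_iff.2 ⟨hα.1, h⟩) fun h => ⟨hα.1, hα.2.1, h⟩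
    · rintro α (hα | ⟨_, h2, h3⟩)
      · exact delta_subset_PF hS hloc (mem_delta_iff.1 hα).1 (mem_delta_iff.1 hα).2
      · exact (h h3).resolve_left h2

/-- The dual of `S \ {0}` for an almost symmetric local `S ≠ ℕ^d`. -/
theorem IsAlmostSymmetric.union_PF_eq (hS : IsGood S) (hloc : IsLocal S)
    (hne : (S : Set (Fin d → ℤ)) ≠ natVec d) (h : IsAlmostSymmetric S) :
    (S : Set (Fin d → ℤ)) ∪ PF S =
      dualSet ((S : Set (Fin d → ℤ)) \ {0}) (gam (S : Set (Fin d → ℤ))) := by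
  ext α
  rw [mem_dualSet_sdiff_zero hS hloc]
  constructor
  · rintro (hα | hα)
    · exact Or.inl (hS.subset_dualSet hα)
    · exact (PF_subset hS hα).symm
  · rintro (hα | hα)
    · exact (isAlmostSymmetric_iff hS hloc).1 h hα
    · refine Or.inr (delta_subset_PF hS hloc (le_trans (fun i => ?_) (le_of_mem_delta hα)) hα)
      change 0 ≤ gam (S : Set (Fin d → ℤ)) i
      -- all components of the conductor are positive, since it is a nonzero element of `S`
      have hc : gam (S : Set (Fin d → ℤ)) + 1 ∈ S := hS.mem_of_gam_lt le_rfl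
      have : 0 < gam (S : Set (Fin d → ℤ)) i + 1 :=
        hloc.pos hS hc (fun h0 => not_le_zero hS hne h0.le) i
      omega

theorem IsAlmostSymmetric.levelDuality_setZ (hd : 1 ≤ d) (hS : IsGood S) (hloc : IsLocal S)
    (hne : (S : Set (Fin d → ℤ)) ≠ natVec d) (h : IsAlmostSymmetric S) :
    LevelDuality ((S : Set (Fin d → ℤ)) ∪ PF S) (setZ S) := by
  have hT : IsGoodSet ((S : Set (Fin d → ℤ)) ∪ PF S) := by
    rw [h.union_PF_eq hS hloc hne]
    exact isGoodSet_dualSet (hS.isGoodSet_sdiff_zero hd hloc) (fun α hα => hS.nonneg α hα.1) _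
  refine levelDuality_of_dualSet hd hT (fun α => nonneg_of_mem_union_PF hS) setZ_subset
    (γ := gam (S : Set (Fin d → ℤ))) ?_ zero_mem_setZ
  rw [union_PF_sdiff_setZ]
  ext α
  constructor
  · rintro ⟨hα, hα0⟩
    refine mem_dualSet.2 fun β hβ hmem => hS.notMem_of_mem_delta_gam hmem ?_
    rw [add_comm]
    exact add_mem_of_mem_union_PF hβ hα hα0
  · intro hα
    have hKT := (isAlmostSymmetric_iff hS hloc).1 h
    refine ⟨?_, ?_⟩
    · -- a face at `α` missed by `S` yields an element of the canonical ideal dual to `α`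
      refine mem_of_forall_meetsFace hd hS.inf_mem fun i => ?_
      by_contra hi
      have hK : MeetsFace (dualSet (S : Set (Fin d → ℤ)) (gam (S : Set (Fin d → ℤ))))
          (gam (S : Set (Fin d → ℤ)) + 1 - α - unitVec i) i := by
        rw [meetsFace_dualSet hS.isGoodSet hS.nonneg]
        convert hi using 2
        ring
      obtain ⟨β, hβ, h1, h2⟩ := meetsFace_delta.1 hK
      exact mem_dualSet.1 hα β (hKT hβ) (mem_delta.2 ⟨trivial, i, h1, h2⟩)
    · rintro rfl
      obtain ⟨x, hx0, hx⟩ := exists_nonneg_mem_delta_gam hS hne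
      exact mem_dualSet.1 hα x (Or.inr (delta_subset_PF hS hloc hx0 hx)) (by rwa [zero_add])

theorem IsAlmostSymmetric.levelDuality_setW (hd : 1 ≤ d) (hS : IsGood S) (hloc : IsLocal S)
    (h : IsAlmostSymmetric S) : LevelDuality (S : Set (Fin d → ℤ)) (setW S) := by
  refine levelDuality_of_dualSet hd hS.isGoodSet hS.nonneg (setW_subset hd hS hloc)
    (γ := gam (S : Set (Fin d → ℤ)) + mult S) ?_ zero_mem_setW
  ext α
  rw [mem_dualSet_add_iff, Set.mem_sdiff, mem_setW hd hS hloc, mem_delta_add_iff, mem_Ap]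
  constructor
  · rintro ⟨hα, hW⟩
    by_cases hS' : α - mult S ∈ S
    · exact hS.subset_dualSet hS'
    · have hPF : α - mult S ∈ PF S := by
        by_contra hPF
        exact hW (Or.inr ⟨⟨hα, hS'⟩, hPF⟩)
      exact (PF_subset hS hPF).resolve_left fun h => hW (Or.inl h)
  · intro hK
    have hT := (isAlmostSymmetric_iff hS hloc).1 h hK
    refine ⟨?_, ?_⟩
    · have := add_mem_of_mem_union_PF hT hS.mult_mem (hS.mult_ne_zero hd)
      rwa [sub_add_cancel] at this
    · rintro (hW | ⟨⟨_, hW⟩, hPF⟩)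
      · exact mem_dualSet.1 hK 0 S.zero_mem (by rwa [add_zero])
      · exact hT.elim hW hPF

theorem isAlmostSymmetric_of_levelDuality (hd : 1 ≤ d) (hS : IsGood S) (hloc : IsLocal S)
    (hne : (S : Set (Fin d → ℤ)) ≠ natVec d)
    (hZ : LevelDuality ((S : Set (Fin d → ℤ)) ∪ PF S) (setZ S))
    (hW : LevelDuality (S : Set (Fin d → ℤ)) (setW S)) : IsAlmostSymmetric S := by
  rw [isAlmostSymmetric_iff hS hloc]
  intro α hα
  by_cases hαS : α ∈ S
  · exact Or.inl hαS
  obtain ⟨n, h1, h2⟩ := hS.exists_nsmul_mult hαS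
  have hAp : α + n • mult S + mult S ∈ Ap S := mem_Ap.2 ⟨h2, by rwa [add_sub_cancel_right]⟩
  -- duality of `W` forces the last vector outside `S` to be pseudo-Frobenius …
  have hPF : α + n • mult S ∈ PF S := by
    by_contra hPF
    obtain ⟨ω, hω, hmem⟩ := hW.exists_dual (remaining_setW hd hS hloc)
      ((mem_setW hd hS hloc).2 (Or.inr ⟨hAp, by rwa [add_sub_cancel_right]⟩))
    rw [gam_sdiff_setW hd hS hloc, mem_delta_sub, add_comm ω] at hmem
    have hK := add_mem_dualSet hα (S.nsmul_mem hS.mult_mem n)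
    rw [← add_sub_cancel_right (α + n • mult S) (mult S), ← mem_dualSet_add_iff] at hK
    exact mem_dualSet.1 hK ω (setW_subset hd hS hloc hω) hmem.2
  -- … and duality of `Z` then forces it to be `α` itself
  rcases Nat.eq_zero_or_pos n with rfl | hn
  · rw [zero_nsmul, add_zero] at hPF
    exact Or.inr hPF
  · obtain ⟨ω, hω, hmem⟩ := exists_dual_setZ hS hne hZ (Or.inl hPF)
    have hpos : ∀ i, 0 < (n • mult S) i := fun i => by
      rw [Pi.smul_apply]
      exact nsmul_pos (hS.mult_pos i) (by omega)
    have hωS : ω + n • mult S ∈ S :=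
      add_mem_of_mem_union_PF (setZ_subset hω) (S.nsmul_mem hS.mult_mem n) fun h0 => by
        have := hpos ⟨0, hd⟩
        rw [h0] at this
        exact lt_irrefl _ this
    refine absurd ?_ (mem_dualSet.1 hα _ hωS)
    rwa [add_left_comm]

end AlmostSymmetric

/-! ### The semigroup of natural numbers -/

theorem delta_fin_one {γ α : Fin 1 → ℤ} : α ∈ delta Set.univ γ ↔ α = γ := by
  rw [mem_delta]
  constructor
  · rintro ⟨_, i, h, _⟩
    funext j
    rwa [Subsingleton.elim j i]
  · rintro rfl
    exact ⟨trivial, 0, rfl, fun j hj => absurd (Subsingleton.elim j 0) hj⟩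

section Nat

variable {S : AddSubmonoid (Fin 1 → ℤ)}

theorem isLocal_fin_one : IsLocal S := fun β _ i h => funext fun j => by
  rw [Subsingleton.elim j i, h]; rfl

theorem nonneg_fin_one {α : Fin 1 → ℤ} : 0 ≤ α ↔ 0 ≤ α 0 := by
  simp [Pi.le_def]

theorem levelDuality_natVec_zero :
    LevelDuality (natVec 1) ({0} : Set (Fin 1 → ℤ)) := by
  have hT : IsGoodSet (natVec 1) := ⟨fun α hα β hβ => show 0 ≤ α ⊓ β from le_inf hα hβ,
    fun α _ β _ hne i hi =>
      absurd (funext fun j => by rwa [Subsingleton.elim j i]) hne⟩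
  refine levelDuality_of_dualSet le_rfl hT (fun α hα => hα) (γ := 0) ?_ ?_ rfl
  · rintro α rfl
    exact le_refl (0 : Fin 1 → ℤ)
  · ext α
    simp only [mem_dualSet, delta_fin_one, Set.mem_sdiff, Set.mem_singleton_iff]
    constructor
    · rintro ⟨hα, h0⟩ β hβ h
      exact h0 (le_antisymm (h ▸ le_add_of_nonneg_right hβ) hα)
    · intro h
      have h1 : 0 < α 0 := by
        by_contra hneg
        exact h (-α) (nonneg_fin_one.2 (by rw [Pi.neg_apply]; omega)) (add_neg_cancel α)
      refine ⟨nonneg_fin_one.2 h1.le, ?_⟩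
      rintro rfl
      exact lt_irrefl _ h1

theorem natVec_almostSymmetric_and_dual (hS : IsGood S)
    (hN : (S : Set (Fin 1 → ℤ)) = natVec 1) :
    IsAlmostSymmetric S ∧ LevelDuality ((S : Set (Fin 1 → ℤ)) ∪ PF S) (setZ S) ∧
      LevelDuality (S : Set (Fin 1 → ℤ)) (setW S) := by
  have hmem : ∀ α, α ∈ S ↔ 0 ≤ α := fun α => by
    rw [← SetLike.mem_coe, hN]; rfl
  have hPF : PF S = ∅ := Set.eq_empty_iff_forall_notMem.2 fun α hα => hα.2.1 ((hmem α).2 hα.1)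
  have hgam : gam (S : Set (Fin 1 → ℤ)) = -1 := gam_eq (fun α hα => (hmem α).2 (by simpa using hα))
    fun α hα h => by
      rw [delta_fin_one] at hα
      subst hα
      exact absurd ((hmem _).1 h 0) (by simp)
  have hmult : mult S = 1 := le_antisymm
    (hS.isLeast_mult.2 ⟨(hmem 1).2 zero_le_one, fun _ => one_pos⟩) hS.one_le_mult
  have hW : setW S = {0} := by
    ext α
    rw [mem_setW le_rfl hS isLocal_fin_one, hgam, hmult, delta_fin_one, mem_Ap, hmult, hmem, hmem,
      hPF, neg_add_cancel, Set.mem_singleton_iff]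
    refine ⟨?_, Or.inl⟩
    rintro (h | ⟨⟨h1, h2⟩, _⟩)
    · exact h
    · rw [nonneg_fin_one] at h1 h2
      simp only [Pi.sub_apply, Pi.one_apply] at h2
      funext j
      rw [Subsingleton.elim j 0, Pi.zero_apply]
      omega
  refine ⟨(isAlmostSymmetric_iff hS isLocal_fin_one).2 fun α hα => Or.inl ((hmem α).2 ?_), ?_, ?_⟩
  · exact nonneg_of_mem_dualSet (fun _ => hS.mem_of_gam_lt) hα
  · rw [setZ, hPF, Set.union_empty, Set.empty_union, hN]
    exact levelDuality_natVec_zero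
  · rw [hW, hN]
    exact levelDuality_natVec_zero

end Nat

theorem isAlmostSymmetric_iff_levelDuality {S : AddSubmonoid (Fin d → ℤ)} (hd : 1 ≤ d)
    (hS : IsGood S) (h : d = 1 ∨ (S : Set (Fin d → ℤ)) ≠ natVec d) :
    IsAlmostSymmetric S ↔ LevelDuality ((S : Set (Fin d → ℤ)) ∪ PF S) (setZ S) ∧
      LevelDuality (S : Set (Fin d → ℤ)) (setW S) := by
  by_cases hne : (S : Set (Fin d → ℤ)) = natVec d
  · obtain rfl := h.resolve_right (not_not.2 hne)
    obtain ⟨h1, h2⟩ := natVec_almostSymmetric_and_dual hS hne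
    exact iff_of_true h1 h2
  by_cases hloc : IsLocal S
  · exact ⟨fun h => ⟨h.levelDuality_setZ hd hS hloc hne, h.levelDuality_setW hd hS hloc⟩,
      fun h => isAlmostSymmetric_of_levelDuality hd hS hloc hne h.1 h.2⟩
  · exact iff_of_false (not_isAlmostSymmetric hS hloc hne)
      fun h => not_levelDuality_setZ hS hloc hne h.1

end GoodSemigroup

theorem mainTheorem2 (d : ℕ) (hd : 1 ≤ d) (S : AddSubmonoid (Fin d → ℤ))
    (hS : GoodSemigroup.IsGood S) :
    (GoodSemigroup.IsSymmetric S ↔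
      GoodSemigroup.LevelDuality (S : Set (Fin d → ℤ)) (GoodSemigroup.Ap S)) ∧
    ((d = 1 ∨ (S : Set (Fin d → ℤ)) ≠ GoodSemigroup.natVec d) →
      (GoodSemigroup.IsAlmostSymmetric S ↔
        GoodSemigroup.LevelDuality ((S : Set (Fin d → ℤ)) ∪ GoodSemigroup.PF S)
          (GoodSemigroup.setZ S) ∧
        GoodSemigroup.LevelDuality (S : Set (Fin d → ℤ)) (GoodSemigroup.setW S))) :=
  ⟨GoodSemigroup.isSymmetric_iff_levelDuality hd hS,
    GoodSemigroup.isAlmostSymmetric_iff_levelDuality hd hS⟩
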